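/- Let $n\ge 2$, let $\mathfrak{gl}(n)$ be the Lie algebra of complex $n\times n$ matrices with matrix units $E_{ij}$, and let $L=(l_{ij})_{1\le j\le i\le n}$ be a complex array that is generic: $l_{ki}-l_{kj}\notin\mathbb Z$ for $1\le i\ne j\le k\le n-1$. Let $T(L)$ denote the corresponding Gelfand–Tsetlin tableau, and let $\delta^{ki}$ be the array with entry $1$ in position $(k,i)$ and $0$ elsewhere. Let $\mathcal B(T(L))$ be the set of tableaux $T(L+z)$, where $z=(z_{ij})_{1\le j\le i\le n}$ is an integral array with $z_{n1}=\dots=z_{nn}=0$, and let $V(T(L))$ be the complex vector space with basis $\mathcal B(T(L))$. For a tableau $T(R)=T(r_{ij})$ put $$\Omega^+(T(R))=\{(p,s,u): 1<p\le n,\ 1\le s\le p,\ 1\le u\le p-1,\ r_{p,s}-r_{p-1,u}\in\mathbb Z_{\ge 0}\}.$$ For $T(R)\in\mathcal B(T(L))$ let $W(T(R))\subseteq V(T(L))$ be the span of $\mathcal N(T(R))=\{T(Q)\in\mathcal B(T(L)):\Omega^+(T(R))\subseteq\Omega^+(T(Q))\}$. The Gelfand–Tsetlin formulas are $$E_{k,k+1}(T(Q))=-\sum_{i=1}^{k}\frac{\prod_{j=1}^{k+1}(q_{ki}-q_{k+1,j})}{\prod_{j\ne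 i}(q_{ki}-q_{kj})}\,T(Q+\delta^{ki})\quad(1\le k\le n-1),$$ $$E_{k+1,k}(T(Q))=\sum_{i=1}^{k}\frac{\prod_{j=1}^{k-1}(q_{ki}-q_{k-1,j})}{\prod_{j\ne i}(q_{ki}-q_{kj})}\,T(Q-\delta^{ki})\quad(1\le k\le n-1),$$ $$E_{kk}(T(Q))=\Bigl(k-1+\sum_{i=1}^{k}q_{ki}-\sum_{i=1}^{k-1}q_{k-1,i}\Bigr)T(Q)\quad(1\le k\le n),$$ where the products $\prod_{j\ne i}$ run over $1\le j\le k$, $j\neq i$. Then there is a unique $\mathfrak{gl}(n)$-module structure on $V(T(L))$ in which the generators $E_{k,k+1}$, $E_{k+1,k}$, $E_{kk}$ act by these formulas, and for every $T(R)\in\mathcal B(T(L))$ the subspace $W(T(R))$ is a $\mathfrak{gl}(n)$-submodule of $V(T(L))$. In particular, the Gelfand–Tsetlin formulas endow $W(T(R))$ with a $\mathfrak{gl}(n)$-module structure. -/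

import Mathlib

open scoped BigOperators

attribute [local instance 100] LieRing.ofAssociativeRing

noncomputable section

namespace GelfandTsetlin

/-- Triangular arrays `l k i` with `1 ≤ i ≤ k ≤ n` and complex entries. Row `k` has `k` entries,
indexed by `Fin k`; row `0` is empty. -/
abbrev Tableau (n : ℕ) : Type := (k : Fin (n + 1)) → Fin k → ℂ

/-- The tableau with a `1` in row `k`, position `i`, and `0` elsewhere. -/
def delta {n : ℕ} (k : Fin (n + 1)) (i : Fin k) : Tableau n := Pi.single k (Pi.single i 1)

/-- In every row except the top row `n`, the differences of distinct entries are not integers. -/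
def IsGeneric {n : ℕ} (L : Tableau n) : Prop :=
  ∀ k : Fin (n + 1), (k : ℕ) < n → ∀ i j : Fin k, i ≠ j → ∀ m : ℤ, L k i - L k j ≠ (m : ℂ)

/-- The tableaux `L + z` with `z` an integral array whose top row is zero. -/
def B {n : ℕ} (L : Tableau n) : Set (Tableau n) :=
  {R | ∃ z : (k : Fin (n + 1)) → Fin k → ℤ, z (Fin.last n) = 0 ∧
    ∀ (k : Fin (n + 1)) (i : Fin k), R k i = L k i + (z k i : ℂ)}

/-- The triples `(p, s, u)` with `1 < p ≤ n`, `1 ≤ s ≤ p`, `1 ≤ u ≤ p - 1`. The first component is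
`q = p - 1`, so that row `p` is row `q.succ` and row `p - 1` is row `q.castSucc`; for `q = 0` there
is no `u`. -/
abbrev Triple (n : ℕ) : Type := Σ q : Fin n, Fin q.succ × Fin q.castSucc

/-- The difference `r_{p,s} - r_{p-1,u}`. -/
def omega {n : ℕ} (t : Triple n) (R : Tableau n) : ℂ := R t.1.succ t.2.1 - R t.1.castSucc t.2.2

/-- The triples `(p, s, u)` for which `r_{p,s} - r_{p-1,u}` is a nonnegative integer. -/
def OmegaPlus {n : ℕ} (R : Tableau n) : Set (Triple n) := {t | ∃ m : ℕ, omega t R = (m : ℂ)}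

/-- The tableaux `Q` in `B L` with `OmegaPlus R ⊆ OmegaPlus Q`. -/
def N {n : ℕ} (L R : Tableau n) : Set (Tableau n) := {Q | Q ∈ B L ∧ OmegaPlus R ⊆ OmegaPlus Q}

/-- The complex vector space with basis the set of all tableaux of height `n`. -/
def Free (n : ℕ) : Type := Tableau n →₀ ℂ

instance (n : ℕ) : AddCommGroup (Free n) := inferInstanceAs (AddCommGroup (Tableau n →₀ ℂ))

instance (n : ℕ) : Module ℂ (Free n) := inferInstanceAs (Module ℂ (Tableau n →₀ ℂ))

/-- The tableaux as a basis of `Free n`. -/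
def tableauBasis (n : ℕ) : Module.Basis (Tableau n) ℂ (Free n) :=
  Module.Basis.ofRepr (LinearEquiv.refl ℂ (Tableau n →₀ ℂ))

/-- The basis vector given by a tableau. -/
def vec {n : ℕ} (T : Tableau n) : Free n := tableauBasis n T

/-- The span of the tableaux in `B L`. -/
def V {n : ℕ} (L : Tableau n) : Submodule ℂ (Free n) := Submodule.span ℂ (vec '' B L)

/-- The span of the tableaux in `N L R`. -/
def W {n : ℕ} (L R : Tableau n) : Submodule ℂ (Free n) := Submodule.span ℂ (vec '' N L R)

/-! In the formulas below, `k : Fin n` stands for the matrix index `k + 1`, so `k.succ` is the row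
with that number and `k.castSucc` is the row before it. In `raiseCoeff` and `raise`, `k'` is meant
to be the index following `k`. -/

/-- The coefficient of `T + δ` in the formula for `E_{k,k+1}`. -/
def raiseCoeff {n : ℕ} (k k' : Fin n) (T : Tableau n) (i : Fin k.succ) : ℂ :=
  -((∏ j : Fin k'.succ, (T k.succ i - T k'.succ j)) /
    ∏ j ∈ Finset.univ.erase i, (T k.succ i - T k.succ j))

/-- The coefficient of `T - δ` in the formula for `E_{k+1,k}`. -/
def lowerCoeff {n : ℕ} (k : Fin n) (T : Tableau n) (i : Fin k.succ) : ℂ :=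
  (∏ j : Fin k.castSucc, (T k.succ i - T k.castSucc j)) /
    ∏ j ∈ Finset.univ.erase i, (T k.succ i - T k.succ j)

/-- The eigenvalue of `E_{k,k}`. -/
def diagCoeff {n : ℕ} (k : Fin n) (T : Tableau n) : ℂ :=
  (k : ℕ) + ∑ i : Fin k.succ, T k.succ i - ∑ i : Fin k.castSucc, T k.castSucc i

/-- The Gelfand-Tsetlin formula for `E_{k,k+1}`, extended linearly. -/
def raise {n : ℕ} (k k' : Fin n) : Free n →ₗ[ℂ] Free n :=
  (tableauBasis n).constr ℂ fun T =>
    ∑ i : Fin k.succ, raiseCoeff k k' T i • vec (T + delta k.succ i)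

/-- The Gelfand-Tsetlin formula for `E_{k+1,k}`, extended linearly. -/
def lower {n : ℕ} (k : Fin n) : Free n →ₗ[ℂ] Free n :=
  (tableauBasis n).constr ℂ fun T =>
    ∑ i : Fin k.succ, lowerCoeff k T i • vec (T - delta k.succ i)

/-- The Gelfand-Tsetlin formula for `E_{k,k}`, extended linearly. -/
def diag {n : ℕ} (k : Fin n) : Free n →ₗ[ℂ] Free n :=
  (tableauBasis n).constr ℂ fun T => diagCoeff k T • vec T

/-- The Lie algebra of all complex `n × n` matrices with the commutator bracket. -/
abbrev gl (n : ℕ) : Type := Matrix (Fin n) (Fin n) ℂ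

/-- A representation of `gl n` on a space `M` of combinations of tableaux in which the standard
generators `E_{k,k+1}`, `E_{k+1,k}`, `E_{k,k}` act by the Gelfand-Tsetlin formulas. -/
def IsGivenByFormulas {n : ℕ} (M : Submodule ℂ (Free n)) (ρ : gl n →ₗ⁅ℂ⁆ Module.End ℂ M) : Prop :=
  (∀ k k' : Fin n, (k' : ℕ) = k + 1 → ∀ v : M,
    (ρ (Matrix.single k k' 1) v : Free n) = raise k k' (v : Free n)) ∧
  (∀ k k' : Fin n, (k' : ℕ) = k + 1 → ∀ v : M,
    (ρ (Matrix.single k' k 1) v : Free n) = lower k (v : Free n)) ∧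
  (∀ (k : Fin n) (v : M), (ρ (Matrix.single k k 1) v : Free n) = diag k (v : Free n))

end GelfandTsetlin

end

/-! Every raising or lowering operator shifts one entry x_i of a row x by 1 or -1, with coefficient,
up to sign, ∏_j (x_i - y_j) / ∏_{j≠i} (x_i - x_j); here y is the next row for raising and the
previous row for lowering. It suffices to check the Chevalley-Serre relations of gl(n) on the
tableaux of `B L`. Genericity keeps the denominators nonzero there, and the top row, which it does
not constrain, is never shifted.

A shift changes only a few linear factors of the other coefficients. The Serre relations therefore
become small rational identities (`serre_coeff_left`, `serre_coeff_right`), as do the vanishing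
brackets of raising and lowering operators of adjacent rows (`commute_coeff`). For one row x with
neighbours y and w, the bracket of raising and lowering is diagonal by `commutator_coeff_ne`. Its
eigenvalue is a sum of residues of ∏(X - y_j) ∏(X - w_j + 1) / ∏(X - x_i)(X - x_i + 1), computed by
Lagrange interpolation in `commutator_coeff_sum`.

To pass from these relations to gl(n), `ChevalleySerre.exists_matrixUnits` builds a full system of
matrix units one row and column at a time, in any Lie ring without additive torsion, and
`matrixLieHom` turns it into a homomorphism. Uniqueness holds because the generators generate
(`eq_top_of_generators_mem`).

For the submodules, a shift by 1 can remove a triple from Ω⁺ only when the difference in question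
drops from 0 to -1. Then two entries of neighbouring rows coincide and the coefficient has a zero
factor (`OmegaPlus_subset_raise`, `OmegaPlus_subset_lower`). -/

/-! ### Matrix units from Chevalley-Serre generators -/

section LieGenerators

variable {A : Type*} [LieRing A]

/-- The commutation relations of the matrix units of size `m`. -/
def MatrixUnitRelations (m : ℕ) (E : ℕ → ℕ → A) : Prop :=
  ∀ i j k l, i < m → j < m → k < m → l < m →
    ⁅E i j, E k l⁆ = (if j = k then E i l else 0) - (if i = l then E k j else 0)

/-- Minus transpose is an automorphism of gl. Through it each result on the new column, generated by
`e`, gives one on the new row, generated by `f`. -/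
theorem MatrixUnitRelations.neg_transpose {m : ℕ} {E : ℕ → ℕ → A}
    (hE : MatrixUnitRelations m E) : MatrixUnitRelations m fun i j => -E j i := by
  intro i j k l hi hj hk hl
  have := hE j i l k hj hi hl hk
  simp only [lie_neg, neg_lie, neg_neg, this]
  split_ifs <;> abel

/-- An element commuting with enough generators commutes with all the matrix units outside the
last column. -/
theorem MatrixUnitRelations.lie_eq_zero {t : ℕ} {E : ℕ → ℕ → A}
    (hE : MatrixUnitRelations (t + 1) E) (z : A) (hd : ∀ i < t, ⁅E i i, z⁆ = 0)
    (hu : ∀ i, i + 1 < t → ⁅E i (i + 1), z⁆ = 0) (hl : ∀ i < t, ⁅E (i + 1) i, z⁆ = 0) :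
    ∀ i j, i ≤ t → j < t → ⁅E i j, z⁆ = 0 := by
  have upper : ∀ d i, i + d < t → ⁅E i (i + d), z⁆ = 0 := by
    intro d
    induction d with
    | zero => intro i hi; exact hd i hi
    | succ d ih =>
      intro i hi
      have h := hE i (i + d) (i + d) (i + d + 1) (by omega) (by omega) (by omega) (by omega)
      rw [if_pos rfl, if_neg (by omega), sub_zero] at h
      rw [← add_assoc, ← h, lie_lie, hu _ (by omega), ih i (by omega)]
      simp
  have lower : ∀ d i, i < t → i + d ≤ t → ⁅E (i + d) i, z⁆ = 0 := by
    intro d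
    induction d with
    | zero => intro i hi _; exact hd i hi
    | succ d ih =>
      intro i hi hid
      have h := hE (i + d + 1) (i + d) (i + d) i (by omega) (by omega) (by omega) (by omega)
      rw [if_pos rfl, if_neg (by omega), sub_zero] at h
      rw [← add_assoc, ← h, lie_lie, hl _ (by omega), ih i (by omega) (by omega)]
      simp
  intro i j hi hj
  rcases le_total i j with h | h
  · obtain ⟨d, rfl⟩ := Nat.exists_eq_add_of_le h
    exact upper d i hj
  · obtain ⟨d, rfl⟩ := Nat.exists_eq_add_of_le h
    exact lower d j hj hi

/-- The matrix units act on the column generated by `e` as on the standard basis. -/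
theorem MatrixUnitRelations.lie_column [IsAddTorsionFree A] {t : ℕ} {E : ℕ → ℕ → A}
    (hE : MatrixUnitRelations (t + 1) E) (e : A)
    (h0 : ∀ i j, i ≤ t → j < t → ⁅E i j, e⁆ = 0) (h1 : ⁅E t t, e⁆ = e)
    (h2 : ∀ s, s + 1 = t → ⁅E s t, ⁅E s t, e⁆⁆ = 0)
    (i j k : ℕ) (hi : i ≤ t) (hj : j ≤ t) (hk : k ≤ t) :
    ⁅E i j, ⁅E k t, e⁆⁆ = if j = k then ⁅E i t, e⁆ else 0 := by
  have key : ∀ i j k, i ≤ t → j ≤ t → k ≤ t → ⁅E i j, ⁅E k t, e⁆⁆ =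
      (if j = k then ⁅E i t, e⁆ else 0) - (if i = t then ⁅E k j, e⁆ else 0)
        + ⁅E k t, ⁅E i j, e⁆⁆ := by
    intro i j k hi hj hk
    rw [leibniz_lie, hE i j k t (by omega) (by omega) (by omega) (by omega), sub_lie]
    split_ifs <;> simp
  have notlast : ∀ i j k, i ≤ t → j < t → k ≤ t →
      ⁅E i j, ⁅E k t, e⁆⁆ = if j = k then ⁅E i t, e⁆ else 0 := by
    intro i j k hi hj hk
    rw [key i j k hi hj.le hk, h0 i j hi hj, h0 k j hk hj]
    simp
  rcases hj.lt_or_eq with hj | rfl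
  · exact notlast i j k hi hj hk
  rcases hk.lt_or_eq with hk | rfl
  swap
  · rw [h1, if_pos rfl]
  rw [if_neg hk.ne']
  rcases hi.lt_or_eq with hi | rfl
  swap
  · rw [key i i k le_rfl le_rfl hk.le, h1, if_neg hk.ne', if_pos rfl]
    abel
  -- What remains is the vanishing of two last-column units applied to `e`, an expression symmetric
  -- in their row indices. The Serre relation `h2` is the case where both indices are `s`;
  -- bracketing with `E i s`, then with `E k s`, moves the indices one at a time. When two equal
  -- terms appear, torsion-freeness removes the factor 2.
  obtain ⟨s, rfl⟩ : ∃ s, j = s + 1 := ⟨j - 1, by omega⟩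
  have symm : ∀ i k, i < s + 1 → k < s + 1 →
      ⁅E i (s + 1), ⁅E k (s + 1), e⁆⁆ = ⁅E k (s + 1), ⁅E i (s + 1), e⁆⁆ := by
    intro i k hi hk
    rw [key i (s + 1) k hi.le le_rfl hk.le, if_neg hk.ne', if_neg hi.ne]
    simp
  have first : ∀ i, i < s + 1 → ⁅E i (s + 1), ⁅E s (s + 1), e⁆⁆ = 0 := by
    intro i hi
    rcases (Nat.lt_succ_iff.mp hi).lt_or_eq with hi' | rfl
    swap
    · exact h2 _ rfl
    have h := congrArg (fun x => ⁅E i s, x⁆) (h2 s rfl)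
    simp only [lie_zero] at h
    rw [leibniz_lie, hE i s s (s + 1) (by omega) (by omega) (by omega) (by omega), if_pos rfl,
      if_neg (by omega), sub_zero, notlast i s s (by omega) (by omega) (by omega), if_pos rfl,
      symm s i (by omega) hi, ← two_nsmul] at h
    simpa using h
  rcases (Nat.lt_succ_iff.mp hk).lt_or_eq with hk' | rfl
  swap
  · exact first i hi
  have h := congrArg (fun x => ⁅E k s, x⁆) (first i hi)
  simp only [lie_zero] at h
  rw [leibniz_lie, hE k s i (s + 1) (by omega) (by omega) (by omega) (by omega),
    if_neg (c := k = s + 1) (by omega), sub_zero, notlast k s s (by omega) (by omega) (by omega),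
    if_pos rfl] at h
  split_ifs at h with hsi
  · subst hsi
    rw [symm s k (by omega) hk, ← two_nsmul] at h
    rw [symm s k (by omega) hk]
    simpa using h
  · simpa using h

/-- The entries of the column generated by `e` commute. -/
theorem MatrixUnitRelations.lie_column_column [IsAddTorsionFree A] {t : ℕ} {E : ℕ → ℕ → A}
    (hE : MatrixUnitRelations (t + 1) E) (e : A)
    (h0 : ∀ i j, i ≤ t → j < t → ⁅E i j, e⁆ = 0) (h1 : ⁅E t t, e⁆ = e)
    (h2 : ∀ s, s + 1 = t → ⁅E s t, ⁅E s t, e⁆⁆ = 0)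
    (h3 : ∀ s, s + 1 = t → ⁅e, ⁅e, E s t⁆⁆ = 0)
    (i j : ℕ) (hi : i ≤ t) (hj : j ≤ t) : ⁅⁅E i t, e⁆, ⁅E j t, e⁆⁆ = 0 := by
  have last : ∀ i ≤ t, ⁅e, ⁅E i t, e⁆⁆ = 0 := by
    intro i hi
    rcases hi.lt_or_eq with hi | rfl
    swap
    · rw [h1, lie_self]
    obtain ⟨s, rfl⟩ : ∃ s, t = s + 1 := ⟨t - 1, by omega⟩
    have hs : ⁅e, ⁅E s (s + 1), e⁆⁆ = 0 := by
      rw [← lie_skew (E s (s + 1)) e, lie_neg, h3 s rfl, neg_zero]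
    rcases (Nat.lt_succ_iff.mp hi).lt_or_eq with hi' | rfl
    swap
    · exact hs
    have h := congrArg (fun x => ⁅E i s, x⁆) hs
    simp only [lie_zero] at h
    rwa [leibniz_lie, h0 i s (by omega) (by omega), zero_lie, zero_add,
      hE.lie_column e h0 h1 h2 i s s (by omega) (by omega) (by omega), if_pos rfl] at h
  rcases hj.lt_or_eq with hj | rfl
  swap
  · rw [h1, ← lie_skew, last i hi, neg_zero]
  -- In the Leibniz expansion the term in which `E i t` hits entry `j` of the column vanishes, since
  -- `j < t`; the other term is the desired bracket.
  have h := congrArg (fun x => ⁅E i t, x⁆) (last j hj.le)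
  simp only [lie_zero] at h
  rwa [leibniz_lie, hE.lie_column e h0 h1 h2 i t j hi le_rfl hj.le, if_neg hj.ne', lie_zero,
    add_zero] at h

/-- The Chevalley-Serre relations for the generators of the Lie algebra of `n × n` matrices. -/
structure ChevalleySerre (n : ℕ) (e f h : ℕ → A) : Prop where
  h_h : ∀ i j, i < n → j < n → ⁅h i, h j⁆ = 0
  h_e : ∀ i j, i < n → j + 1 < n →
    ⁅h i, e j⁆ = (if i = j then e j else 0) - (if i = j + 1 then e j else 0)
  h_f : ∀ i j, i < n → j + 1 < n →
    ⁅h i, f j⁆ = (if i = j + 1 then f j else 0) - (if i = j then f j else 0)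
  e_f : ∀ i, i + 1 < n → ⁅e i, f i⁆ = h i - h (i + 1)
  e_f_ne : ∀ i j, i + 1 < n → j + 1 < n → i ≠ j → ⁅e i, f j⁆ = 0
  e_e : ∀ i j, i + 1 < j → j + 1 < n → ⁅e i, e j⁆ = 0
  f_f : ∀ i j, i + 1 < j → j + 1 < n → ⁅f i, f j⁆ = 0
  e_up : ∀ i, i + 2 < n → ⁅e i, ⁅e i, e (i + 1)⁆⁆ = 0
  e_down : ∀ i, i + 2 < n → ⁅e (i + 1), ⁅e (i + 1), e i⁆⁆ = 0
  f_up : ∀ i, i + 2 < n → ⁅f i, ⁅f i, f (i + 1)⁆⁆ = 0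
  f_down : ∀ i, i + 2 < n → ⁅f (i + 1), ⁅f (i + 1), f i⁆⁆ = 0

/-- One more row and column added to a system of matrix units. -/
def extendUnits (t : ℕ) (E : ℕ → ℕ → A) (X Y : ℕ → A) (H : A) (i j : ℕ) : A :=
  if i = t + 1 then (if j = t + 1 then H else Y j) else (if j = t + 1 then X i else E i j)

theorem MatrixUnitRelations.extendUnits {t : ℕ} {E : ℕ → ℕ → A} {X Y : ℕ → A} {H : A}
    (hE : MatrixUnitRelations (t + 1) E)
    (hEX : ∀ i j k, i ≤ t → j ≤ t → k ≤ t → ⁅E i j, X k⁆ = if j = k then X i else 0)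
    (hEY : ∀ i j k, i ≤ t → j ≤ t → k ≤ t → ⁅E i j, Y k⁆ = -(if i = k then Y j else 0))
    (hEH : ∀ i j, i ≤ t → j ≤ t → ⁅E i j, H⁆ = 0)
    (hXX : ∀ i j, i ≤ t → j ≤ t → ⁅X i, X j⁆ = 0)
    (hYY : ∀ i j, i ≤ t → j ≤ t → ⁅Y i, Y j⁆ = 0)
    (hXY : ∀ i j, i ≤ t → j ≤ t → ⁅X i, Y j⁆ = E i j - if i = j then H else 0)
    (hHX : ∀ i, i ≤ t → ⁅H, X i⁆ = -X i) (hHY : ∀ i, i ≤ t → ⁅H, Y i⁆ = Y i) :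
    MatrixUnitRelations (t + 2) (extendUnits t E X Y H) := by
  have hXE : ∀ i j k, i ≤ t → j ≤ t → k ≤ t → ⁅X k, E i j⁆ = -(if j = k then X i else 0) :=
    fun i j k hi hj hk => by rw [← lie_skew, hEX i j k hi hj hk]
  have hYE : ∀ i j k, i ≤ t → j ≤ t → k ≤ t → ⁅Y k, E i j⁆ = if i = k then Y j else 0 :=
    fun i j k hi hj hk => by rw [← lie_skew, hEY i j k hi hj hk, neg_neg]
  have hHE : ∀ i j, i ≤ t → j ≤ t → ⁅H, E i j⁆ = 0 :=
    fun i j hi hj => by rw [← lie_skew, hEH i j hi hj, neg_zero]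
  have hYX : ∀ i j, i ≤ t → j ≤ t → ⁅Y j, X i⁆ = (if i = j then H else 0) - E i j :=
    fun i j hi hj => by rw [← lie_skew, hXY i j hi hj, neg_sub]
  have hXH : ∀ i, i ≤ t → ⁅X i, H⁆ = X i :=
    fun i hi => by rw [← lie_skew, hHX i hi, neg_neg]
  have hYH : ∀ i, i ≤ t → ⁅Y i, H⁆ = -Y i :=
    fun i hi => by rw [← lie_skew, hHY i hi]
  have cases : ∀ i, i < t + 2 → i = t + 1 ∨ (i ≤ t ∧ i ≠ t + 1 ∧ t + 1 ≠ i) := by omega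
  intro i j k l hi hj hk hl
  rcases cases i hi with rfl | ⟨hi, hi', hi''⟩ <;> rcases cases j hj with rfl | ⟨hj, hj', hj''⟩ <;>
  rcases cases k hk with rfl | ⟨hk, hk', hk''⟩ <;> rcases cases l hl with rfl | ⟨hl, hl', hl''⟩ <;>
  simp only [_root_.extendUnits, if_true, if_false, *, lie_self, sub_self, sub_zero, zero_sub]
  · simp only [@eq_comm _ k j]
  · simp only [@eq_comm _ k j]
  · simp only [@eq_comm _ l i]
  · exact hE i j k l (by omega) (by omega) (by omega) (by omega)

/-- Generators satisfying the Chevalley-Serre relations extend to a system of matrix units. -/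
theorem ChevalleySerre.exists_matrixUnits [IsAddTorsionFree A] {n : ℕ} {e f h : ℕ → A}
    (H : ChevalleySerre n e f h) : ∀ m, m + 1 ≤ n → ∃ E : ℕ → ℕ → A,
      MatrixUnitRelations (m + 1) E ∧ (∀ i < m + 1, E i i = h i) ∧
      ∀ i < m, E i (i + 1) = e i ∧ E (i + 1) i = f i := by
  intro m
  induction m with
  | zero =>
    intro hn
    refine ⟨fun _ _ => h 0, ?_, fun i hi => by rw [Nat.lt_one_iff.mp hi], fun i hi => by omega⟩
    intro i j k l hi hj hk hl
    obtain rfl : i = 0 := by omega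
    obtain rfl : j = 0 := by omega
    obtain rfl : k = 0 := by omega
    obtain rfl : l = 0 := by omega
    simp
  | succ t ih =>
    intro hn
    obtain ⟨E, hE, hd, hg⟩ := ih (by omega)
    have hE' := hE.neg_transpose
    have hef : ⁅e t, f t⁆ = h t - h (t + 1) := H.e_f t (by omega)
    have e0 : ∀ i j, i ≤ t → j < t → ⁅E i j, e t⁆ = 0 := by
      refine hE.lie_eq_zero (e t) (fun i hi => ?_) (fun i hi => ?_) (fun i hi => ?_)
      · rw [hd i (by omega), H.h_e i t (by omega) (by omega), if_neg (by omega),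
          if_neg (by omega), sub_zero]
      · rw [(hg i (by omega)).1, H.e_e i t (by omega) (by omega)]
      · rw [(hg i (by omega)).2, ← lie_skew, H.e_f_ne t i (by omega) (by omega) (by omega),
          neg_zero]
    have f0 : ∀ i j, i ≤ t → j < t → ⁅-E j i, f t⁆ = 0 := by
      refine hE'.lie_eq_zero (f t) (fun i hi => ?_) (fun i hi => ?_) (fun i hi => ?_)
      · rw [neg_lie, hd i (by omega), H.h_f i t (by omega) (by omega), if_neg (by omega),
          if_neg (by omega), sub_zero, neg_zero]
      · rw [neg_lie, (hg i (by omega)).2, H.f_f i t (by omega) (by omega), neg_zero]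
      · rw [neg_lie, (hg i (by omega)).1, H.e_f_ne i t (by omega) (by omega) (by omega), neg_zero]
    have e1 : ⁅E t t, e t⁆ = e t := by
      rw [hd t (by omega), H.h_e t t (by omega) (by omega), if_pos rfl, if_neg (by omega), sub_zero]
    have f1 : ⁅-E t t, f t⁆ = f t := by
      rw [neg_lie, hd t (by omega), H.h_f t t (by omega) (by omega), if_pos rfl,
        if_neg (by omega), zero_sub, neg_neg]
    have e2 : ∀ s, s + 1 = t → ⁅E s t, ⁅E s t, e t⁆⁆ = 0 := by
      rintro s rfl
      rw [(hg s (by omega)).1, H.e_up s (by omega)]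
    have f2 : ∀ s, s + 1 = t → ⁅-E t s, ⁅-E t s, f t⁆⁆ = 0 := by
      rintro s rfl
      rw [(hg s (by omega)).2, neg_lie, neg_lie, lie_neg, H.f_up s (by omega), neg_zero, neg_zero]
    have e3 : ∀ s, s + 1 = t → ⁅e t, ⁅e t, E s t⁆⁆ = 0 := by
      rintro s rfl
      rw [(hg s (by omega)).1, H.e_down s (by omega)]
    have f3 : ∀ s, s + 1 = t → ⁅f t, ⁅f t, -E t s⁆⁆ = 0 := by
      rintro s rfl
      rw [(hg s (by omega)).2, lie_neg, lie_neg, H.f_down s (by omega), neg_zero]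
    have hEX := hE.lie_column (e t) e0 e1 e2
    have hEY := hE'.lie_column (f t) f0 f1 f2
    have hXX := hE.lie_column_column (e t) e0 e1 e2 e3
    have hYY := hE'.lie_column_column (f t) f0 f1 f2 f3
    have hEH : ∀ i j, i ≤ t → j ≤ t → ⁅E i j, h (t + 1)⁆ = 0 := by
      have up : ∀ i, i + 1 < t + 1 → ⁅E i (i + 1), h (t + 1)⁆ = 0 := fun i hi => by
        rw [(hg i (by omega)).1, ← lie_skew, H.h_e _ _ (by omega) (by omega), if_neg (by omega),
          if_neg (by omega), sub_zero, neg_zero]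
      have down : ∀ i, i < t → ⁅E (i + 1) i, h (t + 1)⁆ = 0 := fun i hi => by
        rw [(hg i (by omega)).2, ← lie_skew, H.h_f _ _ (by omega) (by omega), if_neg (by omega),
          if_neg (by omega), sub_zero, neg_zero]
      have dg : ∀ i, i < t + 1 → ⁅E i i, h (t + 1)⁆ = 0 := fun i hi => by
        rw [hd i (by omega), H.h_h _ _ (by omega) (by omega)]
      -- `lie_eq_zero` misses the last column; the transposed system supplies it.
      have A1 := hE.lie_eq_zero (h (t + 1)) (fun i hi => dg i (by omega))
        (fun i hi => up i (by omega)) down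
      have A2 := hE'.lie_eq_zero (h (t + 1)) (fun i hi => by rw [neg_lie, dg i (by omega), neg_zero])
        (fun i hi => by rw [neg_lie, down i (by omega), neg_zero])
        (fun i hi => by rw [neg_lie, up i (by omega), neg_zero])
      intro i j hi hj
      rcases hj.lt_or_eq with hj | rfl
      · exact A1 i j hi hj
      rcases hi.lt_or_eq with hi | rfl
      · have := A2 j i hj hi
        rwa [neg_lie, neg_eq_zero] at this
      · exact dg i (by omega)
    have hHe : ⁅h (t + 1), e t⁆ = -e t := by
      rw [H.h_e _ _ (by omega) (by omega), if_pos rfl, if_neg (by omega), zero_sub]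
    have hHf : ⁅h (t + 1), f t⁆ = f t := by
      rw [H.h_f _ _ (by omega) (by omega), if_pos rfl, if_neg (by omega), sub_zero]
    have hHE : ∀ i j, i ≤ t → j ≤ t → ⁅h (t + 1), E i j⁆ = 0 :=
      fun i j hi hj => by rw [← lie_skew, hEH i j hi hj, neg_zero]
    have hXf : ∀ i, i ≤ t → ⁅⁅E i t, e t⁆, f t⁆ = E i t - if i = t then h (t + 1) else 0 := by
      intro i hi
      rcases hi.lt_or_eq with hi | rfl
      · have : ⁅E i t, f t⁆ = 0 := by
          have := f0 t i le_rfl hi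
          rwa [neg_lie, neg_eq_zero] at this
        rw [lie_lie, this, lie_zero, sub_zero, hef, lie_sub, hEH i t hi.le le_rfl, ← hd t (by omega),
          hE i t t t (by omega) (by omega) (by omega) (by omega), if_pos rfl,
          if_neg hi.ne, if_neg hi.ne, sub_zero]
      · rw [e1, if_pos rfl, hd i (by omega), hef]
    -- At index `t` the new column and row return `e t` and `f t` themselves, by `e1` and `f1`, so
    -- the new generators sit next to the diagonal.
    refine ⟨extendUnits t E (fun i => ⁅E i t, e t⁆) (fun i => ⁅-E t i, f t⁆) (h (t + 1)),
      hE.extendUnits hEX ?_ hEH hXX hYY ?_ ?_ ?_, ?_, ?_⟩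
    · intro i j k hi hj hk
      have := hEY j i k hj hi hk
      rw [neg_lie (E i j)] at this
      rw [← this, neg_neg]
    · intro i j hi hj
      have hc : ⁅⁅E i t, e t⁆, E t j⁆ = -(if i = j then e t else 0) := by
        rw [← lie_skew, hEX t j i le_rfl hj hi, e1]
        simp only [@eq_comm _ j i]
      rcases hj.lt_or_eq with hj | rfl
      swap
      · rw [f1, hXf i hi]
      have hH : ⁅E t j, if i = t then h (t + 1) else 0⁆ = 0 := by
        split_ifs
        · exact hEH t j le_rfl hj.le
        · exact lie_zero _
      rw [neg_lie, lie_neg, leibniz_lie, hc, hXf i hi, neg_lie, lie_sub, hH,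
        hE t j i t (by omega) (by omega) (by omega) (by omega), if_pos rfl]
      simp only [@eq_comm _ j i]
      split_ifs
      · rw [hef, hd t (by omega)]; abel
      · simp
    · intro i hi
      rw [leibniz_lie, hHE i t hi le_rfl, zero_lie, zero_add, hHe, lie_neg]
    · intro i hi
      rw [leibniz_lie, lie_neg, hHE t i le_rfl hi, neg_zero, zero_lie, zero_add, hHf]
    · intro i hi
      rcases (Nat.lt_succ_iff.mp hi).lt_or_eq with hi | rfl
      · rw [extendUnits, if_neg (by omega), if_neg (by omega), hd i hi]
      · simp [extendUnits]
    · intro i hi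
      rcases (Nat.lt_succ_iff.mp hi).lt_or_eq with hi | rfl
      · rw [extendUnits, if_neg (by omega), if_neg (by omega), extendUnits, if_neg (by omega),
          if_neg (by omega)]
        exact hg i hi
      · simp only [extendUnits, if_pos, if_neg (show ¬ i = i + 1 by omega)]
        exact ⟨e1, f1⟩

end LieGenerators

/-! ### Generation of gl(n) and homomorphisms out of it -/

namespace GelfandTsetlin

/-- A Lie subalgebra of `gl n` containing the standard generators is everything. -/
theorem eq_top_of_generators_mem {n : ℕ} (S : LieSubalgebra ℂ (gl n))
    (hu : ∀ k k' : Fin n, (k' : ℕ) = k + 1 → Matrix.single k k' 1 ∈ S)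
    (hl : ∀ k k' : Fin n, (k' : ℕ) = k + 1 → Matrix.single k' k 1 ∈ S)
    (hd : ∀ k : Fin n, Matrix.single k k 1 ∈ S) : S = ⊤ := by
  have step : ∀ i j k : Fin n, k ≠ i → Matrix.single i j (1 : ℂ) ∈ S →
      Matrix.single j k (1 : ℂ) ∈ S → Matrix.single i k (1 : ℂ) ∈ S := by
    intro i j k hki h1 h2
    have := S.lie_mem h1 h2
    rwa [LieRing.of_associative_ring_bracket, Matrix.single_mul_single_same,
      Matrix.single_mul_single_of_ne _ _ _ _ hki, sub_zero, mul_one] at this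
  have units : ∀ d : ℕ, ∀ i j : Fin n, (j : ℕ) = i + d →
      Matrix.single i j (1 : ℂ) ∈ S ∧ Matrix.single j i (1 : ℂ) ∈ S := by
    intro d
    induction d with
    | zero =>
      intro i j h
      obtain rfl : i = j := Fin.ext (by omega)
      exact ⟨hd i, hd i⟩
    | succ d ih =>
      intro i j h
      have hn := j.isLt
      have hij : j ≠ i := fun h' => by rw [h'] at h; omega
      obtain ⟨h1, h2⟩ := ih i ⟨i + d, by omega⟩ rfl
      exact ⟨step _ _ _ hij h1 (hu _ _ (by simp; omega)),
        step _ _ _ hij.symm (hl ⟨i + d, by omega⟩ _ (by simp; omega)) h2⟩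
  rw [eq_top_iff]
  intro M _
  rw [Matrix.matrix_eq_sum_single M]
  refine sum_mem fun i _ => sum_mem fun j _ => ?_
  have : Matrix.single i j (1 : ℂ) ∈ S := by
    rcases le_total (i : ℕ) j with h | h
    · exact (units (j - i) i j (by omega)).1
    · exact (units (i - j) j i (by omega)).2
  simpa [Matrix.smul_single] using S.smul_mem (M i j) this

/-- The linear map sending the matrix units to a given family. -/
def matrixLift {A : Type*} [AddCommGroup A] [Module ℂ A] (n : ℕ) (E : ℕ → ℕ → A) :
    gl n →ₗ[ℂ] A where
  toFun M := ∑ i : Fin n, ∑ j : Fin n, M i j • E i j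
  map_add' M N := by simp [add_smul, Finset.sum_add_distrib]
  map_smul' c M := by simp [smul_smul, Finset.smul_sum]

theorem matrixLift_single {A : Type*} [AddCommGroup A] [Module ℂ A] {n : ℕ} (E : ℕ → ℕ → A)
    (i j : Fin n) (c : ℂ) : matrixLift n E (Matrix.single i j c) = c • E i j := by
  rw [matrixLift, LinearMap.coe_mk, AddHom.coe_mk, Finset.sum_eq_single i, Finset.sum_eq_single j]
  · simp
  · intro b _ hb
    simp [Matrix.single_apply_of_col_ne _ _ hb.symm]
  · simp
  · intro b _ hb
    simp [Matrix.single_apply_of_row_ne hb.symm]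
  · simp

/-- A system of matrix units in a Lie algebra gives a homomorphism from `gl n`. -/
def matrixLieHom {A : Type*} [LieRing A] [LieAlgebra ℂ A] (n : ℕ) (E : ℕ → ℕ → A)
    (hE : MatrixUnitRelations n E) : gl n →ₗ⁅ℂ⁆ A where
  toLinearMap := matrixLift n E
  map_lie' := by
    intro M N
    show matrixLift n E ⁅M, N⁆ = ⁅matrixLift n E M, matrixLift n E N⁆
    induction M using Matrix.induction_on' with
    | h_zero => simp
    | h_add p q hp hq => rw [add_lie, map_add, map_add, add_lie, hp, hq]
    | h_std_basis i j x =>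
      induction N using Matrix.induction_on' with
      | h_zero => simp
      | h_add p q hp hq => rw [lie_add, map_add, map_add, lie_add, hp, hq]
      | h_std_basis k l y =>
        rw [LieRing.of_associative_ring_bracket, map_sub, matrixLift_single, matrixLift_single,
          smul_lie, lie_smul, hE i j k l i.2 j.2 k.2 l.2, smul_sub, smul_sub]
        congr 1
        · by_cases h : j = k
          · subst h
            rw [Matrix.single_mul_single_same, matrixLift_single, if_pos rfl, smul_smul]
          · rw [Matrix.single_mul_single_of_ne _ _ _ _ h, if_neg (by simpa [Fin.ext_iff] using h)]
            simp
        · by_cases h : i = l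
          · subst h
            rw [Matrix.single_mul_single_same, matrixLift_single, if_pos rfl, smul_smul, mul_comm]
          · rw [Matrix.single_mul_single_of_ne _ _ _ _ (Ne.symm h),
              if_neg (by simpa [Fin.ext_iff] using h)]
            simp

theorem matrixLieHom_single {A : Type*} [LieRing A] [LieAlgebra ℂ A] {n : ℕ} {E : ℕ → ℕ → A}
    (hE : MatrixUnitRelations n E) (i j : Fin n) :
    matrixLieHom n E hE (Matrix.single i j 1) = E i j :=
  (matrixLift_single E i j 1).trans (one_smul _ _)

/-! ### Rational identities between the coefficients -/

section Coefficients

variable {ι κ μ : Type*} [Fintype ι] [DecidableEq ι] [Fintype κ] [Fintype μ]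

/-- The coefficient in the Gelfand-Tsetlin formulas, as a function of the shifted row `x` and the
neighbouring row `y`. -/
noncomputable def rowCoeff (x : ι → ℂ) (y : κ → ℂ) (i : ι) : ℂ :=
  (∏ j, (x i - y j)) / ∏ j ∈ Finset.univ.erase i, (x i - x j)

/-- The coefficient without the factor for `x i'`. -/
noncomputable def rowCoeffErase (x : ι → ℂ) (y : κ → ℂ) (i i' : ι) : ℂ :=
  (∏ j, (x i - y j)) / ∏ j ∈ (Finset.univ.erase i).erase i', (x i - x j)

theorem rowCoeff_eq_erase (x : ι → ℂ) (y : κ → ℂ) {i i' : ι} (h : i ≠ i') :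
    rowCoeff x y i = rowCoeffErase x y i i' / (x i - x i') := by
  rw [rowCoeff, rowCoeffErase, ← Finset.mul_prod_erase (Finset.univ.erase i) _
    (Finset.mem_erase.mpr ⟨h.symm, Finset.mem_univ i'⟩), div_div, mul_comm (x i - x i')]

theorem rowCoeffErase_add_single (x : ι → ℂ) (y : κ → ℂ) {i i' : ι} (h : i ≠ i') (s : ℂ) :
    rowCoeffErase (x + Pi.single i' s) y i i' = rowCoeffErase x y i i' := by
  have hi : (x + Pi.single i' s : ι → ℂ) i = x i := by simp [h]
  rw [rowCoeffErase, rowCoeffErase, hi]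
  congr 1
  refine Finset.prod_congr rfl fun j hj => ?_
  simp [Finset.ne_of_mem_erase hj]

/-- Only one denominator factor involves `x i'`. Isolating it reduces identities with two shifted
entries to a few variables. -/
theorem rowCoeff_add_single (x : ι → ℂ) (y : κ → ℂ) {i i' : ι} (h : i ≠ i') (s : ℂ) :
    rowCoeff (x + Pi.single i' s) y i = rowCoeffErase x y i i' / (x i - x i' - s) := by
  rw [rowCoeff_eq_erase _ _ h, rowCoeffErase_add_single _ _ h]
  simp [h, sub_sub]

theorem prod_sub_eq [DecidableEq κ] (a : ℂ) (y : κ → ℂ) (j : κ) :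
    ∏ l, (a - y l) = (a - y j) * ∏ l ∈ Finset.univ.erase j, (a - y l) :=
  (Finset.mul_prod_erase _ _ (Finset.mem_univ j)).symm

theorem prod_sub_add_single [DecidableEq κ] (a : ℂ) (y : κ → ℂ) (j : κ) (s : ℂ) :
    ∏ l, (a - (y + Pi.single j s : κ → ℂ) l) = (a - y j - s) * ∏ l ∈ Finset.univ.erase j, (a - y l) := by
  rw [prod_sub_eq _ _ j]
  congr 1
  · simp [sub_sub]
  · refine Finset.prod_congr rfl fun l hl => ?_
    simp [Finset.ne_of_mem_erase hl]

/-- With d = x_i - y_j, the factors that change are (-d)(d + s) on one side and d(-d - s) on the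
other. -/
theorem commute_coeff [DecidableEq κ] (x : ι → ℂ) (y : κ → ℂ) (s : ℂ) (i : ι) (j : κ) :
    rowCoeff y x j * rowCoeff x (y + Pi.single j (-s)) i =
      rowCoeff x y i * rowCoeff y (x + Pi.single i s) j := by
  simp only [rowCoeff, prod_sub_add_single]
  rw [prod_sub_eq _ x i, prod_sub_eq _ y j]
  ring

/-- The identity behind the Serre relation `[a, [a, b]] = 0`, where `a` shifts `x` and `b` shifts
the neighbouring row `y`. -/
theorem serre_coeff_left [DecidableEq κ] (x : ι → ℂ) (y : κ → ℂ) (s : ℂ)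
    (hx : ∀ i j, i ≠ j → ∀ m : ℤ, x i - x j ≠ m) (hs : s = 1 ∨ s = -1) (i i' : ι) (j : κ) :
    let F := fun i i' =>
      rowCoeff x (y + Pi.single j s) i * rowCoeff (x + Pi.single i s) (y + Pi.single j s) i'
      - 2 * (rowCoeff x y i * rowCoeff (x + Pi.single i s) (y + Pi.single j s) i')
      + rowCoeff x y i * rowCoeff (x + Pi.single i s) y i'
    F i i' + F i' i = 0 := by
  intro F
  by_cases h : i = i'
  · subst h
    simp only [F, rowCoeff, prod_sub_add_single, prod_sub_eq _ y j]
    simp only [Pi.add_apply, Pi.single_eq_same]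
    ring
  · have h1 : x i - x i' ≠ 0 := by simpa using hx i i' h 0
    have h2 : x i' - x i ≠ 0 := by simpa using hx i' i (Ne.symm h) 0
    have h3 : x i - x i' - s ≠ 0 := by
      rcases hs with rfl | rfl
      · simpa [sub_eq_zero] using hx i i' h 1
      · have := hx i i' h (-1)
        push_cast at this
        exact sub_ne_zero.mpr this
    have h4 : x i' - x i - s ≠ 0 := by
      rcases hs with rfl | rfl
      · simpa [sub_eq_zero] using hx i' i (Ne.symm h) 1
      · have := hx i' i (Ne.symm h) (-1)
        push_cast at this
        exact sub_ne_zero.mpr this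
    simp only [F, rowCoeff_add_single _ _ h, rowCoeff_add_single _ _ (Ne.symm h),
      rowCoeff_eq_erase _ _ h, rowCoeff_eq_erase _ _ (Ne.symm h), rowCoeffErase,
      prod_sub_add_single, prod_sub_eq _ y j, mul_div_assoc]
    -- These quotients are common to all terms; what is left is an identity in `x i`, `x i'`, `y j`
    -- and `s`.
    generalize (∏ l ∈ Finset.univ.erase j, (x i - y l)) /
      ∏ l ∈ (Finset.univ.erase i).erase i', (x i - x l) = a
    generalize (∏ l ∈ Finset.univ.erase j, (x i' - y l)) /
      ∏ l ∈ (Finset.univ.erase i').erase i, (x i' - x l) = b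
    field_simp
    ring

/-- The identity behind the Serre relation `[b, [b, a]] = 0`, where `a` shifts `x` and `b` shifts
the neighbouring row `y`. -/
theorem serre_coeff_right [DecidableEq κ] (x : ι → ℂ) (y : κ → ℂ) (z : μ → ℂ) (s : ℂ)
    (hy : ∀ i j, i ≠ j → ∀ m : ℤ, y i - y j ≠ m) (hs : s = 1 ∨ s = -1) (i : ι) (j j' : κ) :
    let F := fun j j' =>
      rowCoeff y z j * rowCoeff (y + Pi.single j s) z j' *
        (rowCoeff x y i - 2 * rowCoeff x (y + Pi.single j s) i +
          rowCoeff x (y + Pi.single j s + Pi.single j' s) i)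
    F j j' + F j' j = 0 := by
  intro F
  by_cases h : j = j'
  -- The coefficient of `x i` is affine in `y j`, so its second difference vanishes.
  · subst h
    simp only [F, add_assoc, ← Pi.single_add]
    simp only [rowCoeff, prod_sub_add_single, prod_sub_eq _ y j]
    ring
  · have h1 : y j - y j' ≠ 0 := by simpa using hy j j' h 0
    have h2 : y j' - y j ≠ 0 := by simpa using hy j' j (Ne.symm h) 0
    have h3 : y j - y j' - s ≠ 0 := by
      rcases hs with rfl | rfl
      · simpa [sub_eq_zero] using hy j j' h 1
      · have := hy j j' h (-1)
        push_cast at this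
        exact sub_ne_zero.mpr this
    have h4 : y j' - y j - s ≠ 0 := by
      rcases hs with rfl | rfl
      · simpa [sub_eq_zero] using hy j' j (Ne.symm h) 1
      · have := hy j' j (Ne.symm h) (-1)
        push_cast at this
        exact sub_ne_zero.mpr this
    simp only [F, rowCoeff_add_single _ _ h, rowCoeff_add_single _ _ (Ne.symm h),
      rowCoeff_eq_erase _ _ h, rowCoeff_eq_erase _ _ (Ne.symm h)]
    have split : ∀ y' : κ → ℂ, (∀ l, l ≠ j → l ≠ j' → y' l = y l) → rowCoeff x y' i =
        (x i - y' j) * (x i - y' j') * ((∏ l ∈ (Finset.univ.erase j).erase j', (x i - y l)) /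
          ∏ l ∈ Finset.univ.erase i, (x i - x l)) := by
      intro y' hy'
      rw [rowCoeff, prod_sub_eq _ _ j, ← Finset.mul_prod_erase (Finset.univ.erase j) _
        (Finset.mem_erase.mpr ⟨Ne.symm h, Finset.mem_univ j'⟩), mul_assoc, mul_div_assoc,
        mul_div_assoc]
      congr 3
      refine Finset.prod_congr rfl fun l hl => ?_
      simp only [Finset.mem_erase] at hl
      rw [hy' l hl.2.1 hl.1]
    have e1 := split (y + Pi.single j s) (fun l h1 _ => by simp [h1])
    have e2 := split (y + Pi.single j' s) (fun l _ h1 => by simp [h1])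
    have e3 := split (y + Pi.single j s + Pi.single j' s) (fun l h1 h2 => by simp [h1, h2])
    have e4 := split (y + Pi.single j' s + Pi.single j s) (fun l h1 h2 => by simp [h1, h2])
    rw [split y (fun _ _ _ => rfl), e1, e2, e3, e4]
    simp only [Pi.add_apply, Pi.single_eq_same, Pi.single_eq_of_ne h, Pi.single_eq_of_ne' h]
    field_simp
    ring

theorem commutator_coeff_ne (x : ι → ℂ) (y : κ → ℂ) (w : μ → ℂ)
    {i j : ι} (h : i ≠ j) :
    rowCoeff x y i * rowCoeff (x + Pi.single i 1) w j =
      rowCoeff x w j * rowCoeff (x + Pi.single j (-1)) y i := by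
  rw [rowCoeff_add_single _ _ h, rowCoeff_add_single _ _ h.symm, rowCoeff_eq_erase _ _ h,
    rowCoeff_eq_erase _ _ h.symm, div_mul_div_comm, div_mul_div_comm, mul_comm]
  congr 1
  ring

open Polynomial in
/-- The residue identity behind the relation for `[E_{k,k+1}, E_{k+1,k}]`. -/
theorem commutator_coeff_sum (x : ι → ℂ) (y : κ → ℂ) (w : μ → ℂ)
    (hx : ∀ i j, i ≠ j → ∀ m : ℤ, x i - x j ≠ m)
    (hι : 0 < Fintype.card ι) (hc : Fintype.card κ + Fintype.card μ = 2 * Fintype.card ι) :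
    ∑ i, (rowCoeff x y i * rowCoeff (x + Pi.single i 1) w i -
      rowCoeff x w i * rowCoeff (x + Pi.single i (-1)) y i) =
    2 * ∑ i, x i - ∑ j, y j - ∑ j, w j + Fintype.card μ - Fintype.card ι := by
  classical
  -- The nodes `v` are the poles and `u` the zeros of the rational function whose residues are
  -- summed. Genericity makes the nodes distinct.
  set v : ι ⊕ ι → ℂ := Sum.elim x fun i => x i - 1 with hv
  set u : κ ⊕ μ → ℂ := Sum.elim y fun j => w j - 1 with hu
  have hcard : (Finset.univ : Finset (ι ⊕ ι)).card = 2 * Fintype.card ι := by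
    rw [Finset.card_univ, Fintype.card_sum, two_mul]
  have hcard' : (Finset.univ : Finset (κ ⊕ μ)).card = 2 * Fintype.card ι := by
    rw [Finset.card_univ, Fintype.card_sum, hc]
  have hinj : Set.InjOn v (Finset.univ : Finset (ι ⊕ ι)) := by
    rintro (i | i) - (j | j) - hij
    · replace hij : x i = x j := hij
      by_contra hne
      exact hx i j (fun h => hne (by rw [h])) 0 (by simp [hij])
    · replace hij : x i = x j - 1 := hij
      exfalso
      by_cases h : i = j
      · subst h
        exact one_ne_zero (α := ℂ) (by linear_combination hij)
      · exact hx i j h (-1) (by rw [hij]; push_cast; ring)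
    · replace hij : x i - 1 = x j := hij
      exfalso
      by_cases h : i = j
      · subst h
        exact one_ne_zero (α := ℂ) (by linear_combination -hij)
      · exact hx i j h 1 (by rw [← hij]; push_cast; ring)
    · replace hij : x i - 1 = x j - 1 := hij
      by_contra hne
      exact hx i j (fun h => hne (by rw [h])) 0 (by push_cast; linear_combination hij)
  -- By `hc` both products are monic of degree 2·|ι|, so the difference can be interpolated at the
  -- nodes, where the nodal polynomial contributes nothing. Its coefficient just below that degree
  -- is ∑ v - ∑ u.
  set P : ℂ[X] := (∏ j, (X - C (u j))) - Lagrange.nodal Finset.univ v with hP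
  have hmonic : (∏ j, (X - C (u j))).Monic := monic_prod_X_sub_C _ _
  have hdeg : P.degree < (Finset.univ : Finset (ι ⊕ ι)).card := by
    have h1 : (∏ j, (X - C (u j))).degree = ((2 * Fintype.card ι : ℕ) : WithBot ℕ) := by
      rw [← hcard']; exact Lagrange.degree_nodal (s := Finset.univ) (v := u)
    have h2 : (Lagrange.nodal Finset.univ v).degree = ((2 * Fintype.card ι : ℕ) : WithBot ℕ) := by
      rw [← hcard]; exact Lagrange.degree_nodal
    rw [hcard, ← h1]
    refine degree_sub_lt_left (h1.trans h2.symm) hmonic.ne_zero ?_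
    rw [hmonic.leadingCoeff, Lagrange.nodal_monic.leadingCoeff]
  have key := Lagrange.coeff_eq_sum hinj hdeg
  have hl : P.coeff (2 * Fintype.card ι - 1) =
      2 * ∑ i, x i - ∑ j, y j - ∑ j, w j + Fintype.card μ - Fintype.card ι := by
    have h1 := prod_X_sub_C_coeff_card_pred Finset.univ u (by omega)
    have h2 := prod_X_sub_C_coeff_card_pred Finset.univ v (by omega)
    rw [hcard'] at h1
    rw [hcard] at h2
    rw [hP, coeff_sub, Lagrange.nodal_eq, h1, h2]
    simp only [hu, hv, Fintype.sum_sum_type, Sum.elim_inl, Sum.elim_inr, Finset.sum_sub_distrib]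
    simp
    ring
  rw [hcard, hl] at key
  have erase_inl : ∀ (g : ι ⊕ ι → ℂ) (i : ι), ∏ m ∈ Finset.univ.erase (Sum.inl i), g m =
      (∏ m ∈ Finset.univ.erase i, g (Sum.inl m)) * ∏ m, g (Sum.inr m) := by
    intro g i
    rw [← Finset.prod_disjSum]
    congr 1
    ext (m | m) <;> simp
  have erase_inr : ∀ (g : ι ⊕ ι → ℂ) (i : ι), ∏ m ∈ Finset.univ.erase (Sum.inr i), g m =
      (∏ m, g (Sum.inl m)) * ∏ m ∈ Finset.univ.erase i, g (Sum.inr m) := by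
    intro g i
    rw [← Finset.prod_disjSum]
    congr 1
    ext (m | m) <;> simp
  have shift : ∀ (s : ℂ) (i : ι), ∏ m ∈ Finset.univ.erase i,
      ((x + Pi.single i s : ι → ℂ) i - (x + Pi.single i s : ι → ℂ) m) =
        ∏ m ∈ Finset.univ.erase i, (x i + s - x m) := by
    intro s i
    refine Finset.prod_congr rfl fun m hm => ?_
    simp [Finset.ne_of_mem_erase hm]
  have evalP : ∀ m, P.eval (v m) = (∏ j, (v m - y j)) * ∏ j, (v m - (w j - 1)) := by
    intro m
    rw [hP, eval_sub, Lagrange.eval_nodal_at_node (Finset.mem_univ m), eval_prod,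
      Fintype.prod_sum_type]
    simp [hu]
  rw [key, Fintype.sum_sum_type, ← Finset.sum_add_distrib]
  refine Finset.sum_congr rfl fun i _ => ?_
  rw [evalP, evalP, erase_inl, erase_inr, rowCoeff, rowCoeff, rowCoeff, rowCoeff, shift, shift,
    sub_eq_add_neg]
  congr 1
  -- The factor pairing x_i with x_i - 1 is 1 here and -1 at the other node, whence the minus sign
  -- in the commutator.
  · rw [← Finset.mul_prod_erase Finset.univ (fun m => v (Sum.inl i) - v (Sum.inr m))
      (Finset.mem_univ i), div_mul_div_comm]
    simp only [hv, Sum.elim_inl, Sum.elim_inr, Pi.add_apply, Pi.single_eq_same, sub_sub_cancel,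
      one_mul, sub_sub_eq_add_sub]
  · rw [← Finset.mul_prod_erase Finset.univ (fun m => v (Sum.inr i) - v (Sum.inl m))
      (Finset.mem_univ i), div_mul_div_comm]
    simp only [hv, Sum.elim_inl, Sum.elim_inr, Pi.add_apply, Pi.single_eq_same,
      sub_sub_sub_cancel_right, sub_sub_cancel_left, ← sub_eq_add_neg, neg_mul,
      div_neg]
    congr 2 <;> ring

end Coefficients

/-! ### Gelfand-Tsetlin operators and their relations on tableaux -/

section Operators

variable {n : ℕ}

/-- The tableau with `s` in row `p`, position `i`, and `0` elsewhere. -/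
def bump (p : Fin (n + 1)) (i : Fin p) (s : ℂ) : Tableau n := Pi.single p (Pi.single i s)

theorem add_bump_same (T : Tableau n) (p : Fin (n + 1)) (i : Fin p) (s : ℂ) :
    (T + bump p i s) p = T p + Pi.single i s := by
  simp [bump]

theorem add_bump_of_ne (T : Tableau n) {p q : Fin (n + 1)} (h : q ≠ p) (i : Fin p) (s : ℂ) :
    (T + bump p i s) q = T q := by
  simp [bump, h]

theorem add_bump_apply (T : Tableau n) (p q : Fin (n + 1)) (i : Fin p) (a : Fin q) (s : ℂ) :
    (T + bump p i s) q a = T q a + if q = p ∧ (a : ℕ) = i then s else 0 := by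
  by_cases h : q = p
  · subst h
    rw [add_bump_same]
    simp [Pi.single_apply, Fin.ext_iff]
  · rw [add_bump_of_ne T h]
    simp [h]

theorem tableau_congr (T : Tableau n) {p q : Fin (n + 1)} (h : p = q) (a : Fin p) (b : Fin q)
    (hab : (a : ℕ) = b) : T p a = T q b := by
  subst h
  rw [Fin.ext hab]

theorem add_delta (T : Tableau n) (p : Fin (n + 1)) (i : Fin p) :
    T + delta p i = T + bump p i 1 := rfl

theorem sub_delta (T : Tableau n) (p : Fin (n + 1)) (i : Fin p) :
    T - delta p i = T + bump p i (-1) := by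
  rw [sub_eq_add_neg, delta, bump, Pi.single_neg, Pi.single_neg]

theorem add_bump_mem_B {L T : Tableau n} (hT : T ∈ B L) {p : Fin (n + 1)} (hp : (p : ℕ) < n)
    (i : Fin p) (s : ℤ) : T + bump p i s ∈ B L := by
  obtain ⟨z, hz, h⟩ := hT
  refine ⟨z + Pi.single p (Pi.single i s), ?_, fun k a => ?_⟩
  · have : Fin.last n ≠ p := fun h => by rw [← h] at hp; simp at hp
    simp [hz, this]
  · rw [add_bump_apply, h]
    by_cases hk : k = p
    · subst hk
      by_cases ha : a = i
      · subst ha; simp [add_assoc]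
      · simp [ha, Fin.val_inj]
    · simp [hk]

theorem IsGeneric.of_mem_B {L T : Tableau n} (hL : IsGeneric L) (hT : T ∈ B L) : IsGeneric T := by
  obtain ⟨z, -, h⟩ := hT
  intro k hk i j hij m hm
  refine hL k hk i j hij (m - z k i + z k j) ?_
  rw [h, h] at hm
  push_cast
  linear_combination hm

/-- The operator shifting the entries of row `p` by `s`, with the Gelfand-Tsetlin coefficients
relative to row `q`. -/
noncomputable def gtOp (p q : Fin (n + 1)) (s : ℂ) : Free n →ₗ[ℂ] Free n :=
  (tableauBasis n).constr ℂ fun T => ∑ i : Fin p, rowCoeff (T p) (T q) i • vec (T + bump p i s)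

theorem gtOp_vec (p q : Fin (n + 1)) (s : ℂ) (T : Tableau n) :
    gtOp p q s (vec T) = ∑ i : Fin p, rowCoeff (T p) (T q) i • vec (T + bump p i s) :=
  Module.Basis.constr_basis _ _ _ _

theorem diag_vec (k : Fin n) (T : Tableau n) : diag k (vec T) = diagCoeff k T • vec T :=
  Module.Basis.constr_basis _ _ _ _

theorem raise_eq (k k' : Fin n) : raise k k' = -gtOp k.succ k'.succ 1 := by
  refine (tableauBasis n).ext fun T => ?_
  rw [raise, Module.Basis.constr_basis]
  refine Eq.trans ?_ (congrArg Neg.neg (gtOp_vec k.succ k'.succ 1 T)).symm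
  rw [← Finset.sum_neg_distrib]
  refine Finset.sum_congr rfl fun i _ => ?_
  rw [add_delta, ← neg_smul]
  rfl

theorem lower_eq (k : Fin n) : lower k = gtOp k.succ k.castSucc (-1) := by
  refine (tableauBasis n).ext fun T => ?_
  rw [lower, Module.Basis.constr_basis]
  refine Eq.trans ?_ (gtOp_vec k.succ k.castSucc (-1) T).symm
  refine Finset.sum_congr rfl fun i _ => ?_
  rw [sub_delta]
  rfl

theorem gtOp_comm_of_ne {p q p' q' : Fin (n + 1)} (h : p ≠ p') (h1 : q ≠ p') (h2 : q' ≠ p)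
    (s s' : ℂ) (T : Tableau n) :
    gtOp p q s (gtOp p' q' s' (vec T)) = gtOp p' q' s' (gtOp p q s (vec T)) := by
  simp only [gtOp_vec, map_sum, map_smul, Finset.smul_sum, smul_smul, add_bump_of_ne _ h,
    add_bump_of_ne _ h.symm, add_bump_of_ne _ h1, add_bump_of_ne _ h2]
  rw [Finset.sum_comm]
  refine Finset.sum_congr rfl fun i _ => Finset.sum_congr rfl fun j _ => ?_
  rw [mul_comm, add_right_comm]

theorem gtOp_comm_adjacent {p q : Fin (n + 1)} (h : p ≠ q) (s : ℂ) (T : Tableau n) :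
    gtOp p q s (gtOp q p (-s) (vec T)) = gtOp q p (-s) (gtOp p q s (vec T)) := by
  simp only [gtOp_vec, map_sum, map_smul, Finset.smul_sum, smul_smul, add_bump_of_ne _ h,
    add_bump_of_ne _ h.symm, add_bump_same]
  rw [Finset.sum_comm]
  refine Finset.sum_congr rfl fun i _ => Finset.sum_congr rfl fun j _ => ?_
  rw [commute_coeff, add_right_comm]

theorem sum_sum_eq_zero {ι M : Type*} [Fintype ι] [AddCommGroup M] [Module ℂ M] (G : ι → ι → M)
    (h : ∀ i j, G i j + G j i = 0) : ∑ i, ∑ j, G i j = 0 := by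
  have h2 : ∑ i, ∑ j, G i j + ∑ i, ∑ j, G i j = 0 := by
    nth_rewrite 2 [Finset.sum_comm]
    simp only [← Finset.sum_add_distrib, h, Finset.sum_const_zero]
  rw [← two_smul ℂ] at h2
  simpa using h2

/-- The resulting tableau is symmetric in the two positions shifted in row `p`, so only the
symmetrised coefficient must vanish. -/
theorem gtOp_serre_left {p q r : Fin (n + 1)} (hpq : p ≠ q) (hpr : p ≠ r) {s : ℂ}
    (hs : s = 1 ∨ s = -1) {T : Tableau n} (hT : IsGeneric T) (hp : (p : ℕ) < n) :
    gtOp p q s (gtOp p q s (gtOp q r s (vec T))) - gtOp p q s (gtOp q r s (gtOp p q s (vec T))) -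
      (gtOp p q s (gtOp q r s (gtOp p q s (vec T))) -
        gtOp q r s (gtOp p q s (gtOp p q s (vec T)))) = 0 := by
  set v : Fin p → Fin p → Fin q → Free n := fun i i' j =>
    vec (T + bump p i s + bump p i' s + bump q j s) with hv
  set x := T p with hx
  set y := T q with hy
  set β := rowCoeff (T q) (T r) with hβ
  have h1 : gtOp p q s (gtOp p q s (gtOp q r s (vec T))) = ∑ i, ∑ i', ∑ j,
      (β j * (rowCoeff x (y + Pi.single j s) i *
        rowCoeff (x + Pi.single i s) (y + Pi.single j s) i')) • v i i' j := by
    simp only [gtOp_vec, map_sum, map_smul, Finset.smul_sum, smul_smul, add_bump_of_ne _ hpq,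
      add_bump_of_ne _ hpq.symm, add_bump_same]
    rw [Finset.sum_comm]
    refine Finset.sum_congr rfl fun i _ => ?_
    rw [Finset.sum_comm]
    refine Finset.sum_congr rfl fun i' _ => Finset.sum_congr rfl fun j _ => ?_
    rw [hv, mul_assoc, add_right_comm T, add_right_comm (T + _)]
  have h2 : gtOp p q s (gtOp q r s (gtOp p q s (vec T))) = ∑ i, ∑ i', ∑ j,
      (β j * (rowCoeff x y i * rowCoeff (x + Pi.single i s) (y + Pi.single j s) i')) • v i i' j := by
    simp only [gtOp_vec, map_sum, map_smul, Finset.smul_sum, smul_smul, add_bump_of_ne _ hpq,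
      add_bump_of_ne _ hpq.symm, add_bump_of_ne _ hpr.symm, add_bump_same]
    refine Finset.sum_congr rfl fun i _ => ?_
    rw [Finset.sum_comm]
    refine Finset.sum_congr rfl fun i' _ => Finset.sum_congr rfl fun j _ => ?_
    rw [hv, add_right_comm (T + _)]
    congr 1
    ring
  have h3 : gtOp q r s (gtOp p q s (gtOp p q s (vec T))) = ∑ i, ∑ i', ∑ j,
      (β j * (rowCoeff x y i * rowCoeff (x + Pi.single i s) y i')) • v i i' j := by
    simp only [gtOp_vec, map_sum, map_smul, Finset.smul_sum, smul_smul,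
      add_bump_of_ne _ hpq.symm, add_bump_of_ne _ hpr.symm, add_bump_same]
    refine Finset.sum_congr rfl fun i _ =>
      Finset.sum_congr rfl fun i' _ => Finset.sum_congr rfl fun j _ => ?_
    congr 1
    ring
  rw [h1, h2, h3]
  simp only [← Finset.sum_sub_distrib, ← sub_smul]
  refine sum_sum_eq_zero _ fun i i' => ?_
  rw [← Finset.sum_add_distrib]
  refine Finset.sum_eq_zero fun j _ => ?_
  have hsymm : v i' i j = v i i' j := by rw [hv]; simp only [add_right_comm T]
  rw [hsymm, ← add_smul]
  have := serre_coeff_left x y s (fun i j hij => hT p hp i j hij) hs i i' j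
  refine (congrArg (· • v i i' j) ?_).trans (zero_smul ℂ _)
  linear_combination β j * this

theorem gtOp_serre_right {p q r : Fin (n + 1)} (hpq : p ≠ q) (hpr : p ≠ r) (hqr : q ≠ r) {s : ℂ}
    (hs : s = 1 ∨ s = -1) {T : Tableau n} (hT : IsGeneric T) (hq : (q : ℕ) < n) :
    gtOp q r s (gtOp q r s (gtOp p q s (vec T))) - gtOp q r s (gtOp p q s (gtOp q r s (vec T))) -
      (gtOp q r s (gtOp p q s (gtOp q r s (vec T))) -
        gtOp p q s (gtOp q r s (gtOp q r s (vec T)))) = 0 := by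
  set v : Fin q → Fin q → Fin p → Free n := fun j j' i =>
    vec (T + bump q j s + bump q j' s + bump p i s) with hv
  set x := T p with hx
  set y := T q with hy
  set z := T r with hz
  have h1 : gtOp q r s (gtOp q r s (gtOp p q s (vec T))) = ∑ j, ∑ j', ∑ i,
      (rowCoeff y z j * rowCoeff (y + Pi.single j s) z j' * rowCoeff x y i) • v j j' i := by
    simp only [gtOp_vec, map_sum, map_smul, Finset.smul_sum, smul_smul, add_bump_of_ne _ hpq.symm,
      add_bump_of_ne _ hpr.symm, add_bump_of_ne _ hqr.symm, add_bump_same]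
    rw [Finset.sum_comm]
    refine Finset.sum_congr rfl fun i _ => ?_
    rw [Finset.sum_comm]
    refine Finset.sum_congr rfl fun i' _ => Finset.sum_congr rfl fun j _ => ?_
    rw [hv, add_right_comm T, add_right_comm (T + _)]
    congr 1
    ring
  have h2 : gtOp q r s (gtOp p q s (gtOp q r s (vec T))) = ∑ j, ∑ j', ∑ i,
      (rowCoeff y z j * rowCoeff (y + Pi.single j s) z j' *
        rowCoeff x (y + Pi.single j s) i) • v j j' i := by
    simp only [gtOp_vec, map_sum, map_smul, Finset.smul_sum, smul_smul, add_bump_of_ne _ hpq.symm,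
      add_bump_of_ne _ hpq, add_bump_of_ne _ hpr.symm, add_bump_of_ne _ hqr.symm, add_bump_same]
    refine Finset.sum_congr rfl fun i _ => ?_
    rw [Finset.sum_comm]
    refine Finset.sum_congr rfl fun i' _ => Finset.sum_congr rfl fun j _ => ?_
    rw [hv, add_right_comm (T + _)]
    congr 1
    ring
  have h3 : gtOp p q s (gtOp q r s (gtOp q r s (vec T))) = ∑ j, ∑ j', ∑ i,
      (rowCoeff y z j * rowCoeff (y + Pi.single j s) z j' *
        rowCoeff x (y + Pi.single j s + Pi.single j' s) i) • v j j' i := by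
    simp only [gtOp_vec, map_sum, map_smul, Finset.smul_sum, smul_smul,
      add_bump_of_ne _ hpq, add_bump_of_ne _ hqr.symm, add_bump_same]
    rfl
  rw [h1, h2, h3]
  simp only [← Finset.sum_sub_distrib, ← sub_smul]
  refine sum_sum_eq_zero _ fun j j' => ?_
  rw [← Finset.sum_add_distrib]
  refine Finset.sum_eq_zero fun i _ => ?_
  have hsymm : v j' j i = v j j' i := by rw [hv]; simp only [add_right_comm T]
  rw [hsymm, ← add_smul]
  have := serre_coeff_right x y z s (fun i j hij => hT q hq i j hij) hs i j j'
  refine (congrArg (· • v j j' i) ?_).trans (zero_smul ℂ _)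
  linear_combination this

/-- Terms shifting two different positions cancel; those returning to `T` sum to the residue
identity. -/
theorem gtOp_commutator {p q r : Fin (n + 1)} (hpq : p ≠ q) (hpr : p ≠ r) {T : Tableau n}
    (hT : IsGeneric T) (hp : (p : ℕ) < n) (hp0 : 0 < (p : ℕ)) (hc : (q : ℕ) + r = 2 * p) :
    gtOp p r (-1) (gtOp p q 1 (vec T)) - gtOp p q 1 (gtOp p r (-1) (vec T)) =
      (2 * ∑ i, T p i - ∑ j, T q j - ∑ j, T r j + (r : ℕ) - (p : ℕ)) • vec T := by
  have h1 : gtOp p r (-1) (gtOp p q 1 (vec T)) = ∑ i, ∑ j,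
      (rowCoeff (T p) (T q) i * rowCoeff (T p + Pi.single i 1) (T r) j) •
        vec (T + bump p i 1 + bump p j (-1)) := by
    simp only [gtOp_vec, map_sum, map_smul, Finset.smul_sum, smul_smul, add_bump_of_ne _ hpr.symm,
      add_bump_same]
  have h2 : gtOp p q 1 (gtOp p r (-1) (vec T)) = ∑ i, ∑ j,
      (rowCoeff (T p) (T r) j * rowCoeff (T p + Pi.single j (-1)) (T q) i) •
        vec (T + bump p i 1 + bump p j (-1)) := by
    simp only [gtOp_vec, map_sum, map_smul, Finset.smul_sum, smul_smul, add_bump_of_ne _ hpq.symm,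
      add_bump_same]
    rw [Finset.sum_comm]
    refine Finset.sum_congr rfl fun i _ => Finset.sum_congr rfl fun j _ => ?_
    rw [add_right_comm]
  have key := commutator_coeff_sum (T p) (T q) (T r) (fun i j hij => hT p hp i j hij)
    (by simpa using hp0) (by simpa using hc)
  simp only [Fintype.card_fin] at key
  rw [h1, h2, ← key, Finset.sum_smul, ← Finset.sum_sub_distrib]
  refine Finset.sum_congr rfl fun i _ => ?_
  rw [← Finset.sum_sub_distrib, Finset.sum_eq_single i]
  · rw [← sub_smul]
    congr 2
    rw [add_assoc, bump, bump, ← Pi.single_add, ← Pi.single_add]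
    simp
  · intro j _ hj
    rw [commutator_coeff_ne _ _ _ hj.symm, sub_self]
  · simp

theorem sum_add_bump (T : Tableau n) (p q : Fin (n + 1)) (i : Fin p) (s : ℂ) :
    ∑ a, (T + bump p i s) q a = ∑ a, T q a + if q = p then s else 0 := by
  by_cases h : q = p
  · subst h
    rw [add_bump_same]
    simp [Finset.sum_add_distrib]
  · simp [add_bump_of_ne _ h, h]

theorem diag_gtOp (k : Fin n) (p q : Fin (n + 1)) (s : ℂ) (T : Tableau n) :
    diag k (gtOp p q s (vec T)) - gtOp p q s (diag k (vec T)) =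
      ((if k.succ = p then s else 0) - if k.castSucc = p then s else 0) •
        gtOp p q s (vec T) := by
  simp only [gtOp_vec, map_sum, map_smul, Finset.smul_sum, smul_smul, diag_vec,
    ← Finset.sum_sub_distrib, ← sub_smul]
  refine Finset.sum_congr rfl fun i _ => ?_
  rw [diagCoeff, diagCoeff, sum_add_bump, sum_add_bump]
  congr 1
  ring

/-! ### Stability of spans of tableaux -/

theorem gtOp_mem_span {S : Set (Tableau n)} {p q : Fin (n + 1)} {s : ℂ}
    (h : ∀ T ∈ S, ∀ i, rowCoeff (T p) (T q) i ≠ 0 → T + bump p i s ∈ S) :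
    ∀ v ∈ Submodule.span ℂ (vec '' S), gtOp p q s v ∈ Submodule.span ℂ (vec '' S) := by
  intro v hv
  refine Submodule.span_le (p := (Submodule.span ℂ (vec '' S)).comap (gtOp p q s)).mpr ?_ hv
  rintro _ ⟨T, hT, rfl⟩
  rw [SetLike.mem_coe, Submodule.mem_comap, gtOp_vec]
  refine sum_mem fun i _ => ?_
  by_cases hc : rowCoeff (T p) (T q) i = 0
  · rw [hc, zero_smul]; exact zero_mem _
  · exact Submodule.smul_mem _ _ (Submodule.subset_span ⟨_, h T hT i hc, rfl⟩)

theorem diag_mem_span {S : Set (Tableau n)} (k : Fin n) :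
    ∀ v ∈ Submodule.span ℂ (vec '' S), diag k v ∈ Submodule.span ℂ (vec '' S) := by
  intro v hv
  refine Submodule.span_le (p := (Submodule.span ℂ (vec '' S)).comap (diag k)).mpr ?_ hv
  rintro _ ⟨T, hT, rfl⟩
  rw [SetLike.mem_coe, Submodule.mem_comap, diag_vec]
  exact Submodule.smul_mem _ _ (Submodule.subset_span ⟨T, hT, rfl⟩)

theorem ne_of_rowCoeff_ne_zero {ι κ : Type*} [Fintype ι] [DecidableEq ι] [Fintype κ] {x : ι → ℂ}
    {y : κ → ℂ} {i : ι} (h : rowCoeff x y i ≠ 0) (j : κ) : x i ≠ y j := by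
  intro hj
  refine h ?_
  rw [rowCoeff, Finset.prod_eq_zero (Finset.mem_univ j) (sub_eq_zero.mpr hj), zero_div]

/-- Raising an entry decreases only its differences with the row above it in number, `k'.succ`. A
difference 0 would become -1, but then the numerator vanishes. -/
theorem OmegaPlus_subset_raise {Q : Tableau n} {k k' : Fin n} (hk : (k' : ℕ) = k + 1)
    {i : Fin k.succ} (h : rowCoeff (Q k.succ) (Q k'.succ) i ≠ 0) :
    OmegaPlus Q ⊆ OmegaPlus (Q + bump k.succ i 1) := by
  rintro ⟨r, a, b⟩ ⟨m, hm⟩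
  simp only [omega] at hm
  have hval : omega ⟨r, a, b⟩ (Q + bump k.succ i 1) =
      m + (if r.succ = k.succ ∧ (a : ℕ) = i then 1 else 0) -
        (if r.castSucc = k.succ ∧ (b : ℕ) = i then 1 else 0) := by
    simp only [omega]
    rw [add_bump_apply, add_bump_apply, ← hm]
    ring
  by_cases h2 : r.castSucc = k.succ ∧ (b : ℕ) = i
  · have hr : r = k' := by
      have := congrArg Fin.val h2.1
      simp at this
      exact Fin.ext (by omega)
    subst hr
    rw [if_pos h2] at hval
    obtain _ | m := m
    · refine absurd ?_ (ne_of_rowCoeff_ne_zero h a)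
      rw [← tableau_congr Q h2.1 b i h2.2]
      exact (sub_eq_zero.mp (by simpa using hm)).symm
    · by_cases h1 : r.succ = k.succ ∧ (a : ℕ) = i
      · exact ⟨m + 1, by rw [hval, if_pos h1]; push_cast; ring⟩
      · exact ⟨m, by rw [hval, if_neg h1]; push_cast; ring⟩
  · rw [if_neg h2] at hval
    by_cases h1 : r.succ = k.succ ∧ (a : ℕ) = i
    · exact ⟨m + 1, by rw [hval, if_pos h1]; push_cast; ring⟩
    · exact ⟨m, by rw [hval, if_neg h1]; ring⟩

/-- Here the endangered differences are those with row `k.castSucc`, whose entries are exactly the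
ones in the numerator. -/
theorem OmegaPlus_subset_lower {Q : Tableau n} {k : Fin n}
    {i : Fin k.succ} (h : rowCoeff (Q k.succ) (Q k.castSucc) i ≠ 0) :
    OmegaPlus Q ⊆ OmegaPlus (Q + bump k.succ i (-1)) := by
  rintro ⟨r, a, b⟩ ⟨m, hm⟩
  simp only [omega] at hm
  have hval : omega ⟨r, a, b⟩ (Q + bump k.succ i (-1)) =
      m - (if r.succ = k.succ ∧ (a : ℕ) = i then 1 else 0) +
        (if r.castSucc = k.succ ∧ (b : ℕ) = i then 1 else 0) := by
    simp only [omega]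
    rw [add_bump_apply, add_bump_apply, ← hm]
    split_ifs <;> ring
  by_cases h1 : r.succ = k.succ ∧ (a : ℕ) = i
  · obtain rfl : r = k := Fin.succ_injective _ h1.1
    rw [if_pos h1] at hval
    obtain _ | m := m
    · refine absurd ?_ (ne_of_rowCoeff_ne_zero h b)
      rw [← tableau_congr Q h1.1 a i h1.2]
      exact sub_eq_zero.mp (by simpa using hm)
    · by_cases h2 : r.castSucc = r.succ ∧ (b : ℕ) = i
      · exact ⟨m + 1, by rw [hval, if_pos h2]; push_cast; ring⟩
      · exact ⟨m, by rw [hval, if_neg h2]; push_cast; ring⟩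
  · rw [if_neg h1] at hval
    by_cases h2 : r.castSucc = k.succ ∧ (b : ℕ) = i
    · exact ⟨m + 1, by rw [hval, if_pos h2]; push_cast; ring⟩
    · exact ⟨m, by rw [hval, if_neg h2]; ring⟩

end Operators

/-! ### The representation on `V L` and its restriction to `W L R` -/

section Representation

variable {n : ℕ}

theorem end_lie_apply {M : Type*} [AddCommGroup M] [Module ℂ M] (F G : Module.End ℂ M) (v : M) :
    ⁅F, G⁆ v = F (G v) - G (F v) := rfl

/-- The endomorphism `a` of a submodule is the restriction of the endomorphism `F`. -/
def Restricts {M : Submodule ℂ (Free n)} (a : Module.End ℂ M) (F : Module.End ℂ (Free n)) : Prop :=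
  ∀ v : M, (a v : Free n) = F v

theorem Restricts.lie {M : Submodule ℂ (Free n)} {a b : Module.End ℂ M}
    {F G : Module.End ℂ (Free n)} (ha : Restricts a F) (hb : Restricts b G) :
    Restricts ⁅a, b⁆ ⁅F, G⁆ := by
  intro v
  rw [end_lie_apply, end_lie_apply, Submodule.coe_sub, ha, hb, hb, ha]

theorem Restricts.sub {M : Submodule ℂ (Free n)} {a b : Module.End ℂ M}
    {F G : Module.End ℂ (Free n)} (ha : Restricts a F) (hb : Restricts b G) :
    Restricts (a - b) (F - G) := by
  intro v
  rw [LinearMap.sub_apply, LinearMap.sub_apply, Submodule.coe_sub, ha, hb]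

theorem Restricts.zero {M : Submodule ℂ (Free n)} :
    Restricts (0 : Module.End ℂ M) 0 := fun _ => rfl

theorem Restricts.ite {M : Submodule ℂ (Free n)} {a : Module.End ℂ M}
    {F : Module.End ℂ (Free n)} (ha : Restricts a F) (P : Prop) [Decidable P] :
    Restricts (if P then a else 0) (if P then F else 0) := by
  split_ifs
  · exact ha
  · exact Restricts.zero

/-- The operators live on all tableaux, but their relations are proved only for generic ones; this
transfers them to `V L`. -/
theorem Restricts.eq {L : Tableau n} {a b : Module.End ℂ (V L)} {F G : Module.End ℂ (Free n)}
    (ha : Restricts a F) (hb : Restricts b G) (h : ∀ T ∈ B L, F (vec T) = G (vec T)) : a = b := by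
  refine LinearMap.ext fun v => Subtype.ext ?_
  rw [ha, hb]
  refine LinearMap.eqOn_span (f := F) (g := G) (s := vec '' B L) ?_ v.2
  rintro _ ⟨T, hT, rfl⟩
  exact h T hT

theorem gtOp_mem_V {L : Tableau n} {p q : Fin (n + 1)} (hp : (p : ℕ) < n) (s : ℤ) :
    ∀ v ∈ V L, gtOp p q s v ∈ V L :=
  gtOp_mem_span fun _ hT i _ => add_bump_mem_B hT hp i s

theorem raise_mem_V {L : Tableau n} {k k' : Fin n} (hk : (k' : ℕ) = k + 1) :
    ∀ v ∈ V L, raise k k' v ∈ V L := by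
  intro v hv
  have := gtOp_mem_V (p := k.succ) (q := k'.succ) (by have := k'.2; simp; omega) 1 v hv
  rw [raise_eq, LinearMap.neg_apply]
  exact neg_mem (by simpa using this)

theorem lower_mem_V {L : Tableau n} {k k' : Fin n} (hk : (k' : ℕ) = k + 1) :
    ∀ v ∈ V L, lower k v ∈ V L := by
  intro v hv
  have := gtOp_mem_V (p := k.succ) (q := k.castSucc) (by have := k'.2; simp; omega) (-1) v hv
  rw [lower_eq]
  simpa using this

theorem raise_mem_W {L R : Tableau n} {k k' : Fin n} (hk : (k' : ℕ) = k + 1) :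
    ∀ v ∈ W L R, raise k k' v ∈ W L R := by
  intro v hv
  rw [raise_eq, LinearMap.neg_apply]
  refine neg_mem (gtOp_mem_span (S := N L R) (fun T hT i h => ⟨?_, ?_⟩) v hv)
  · simpa using add_bump_mem_B hT.1 (p := k.succ) (by have := k'.2; simp; omega) i 1
  · exact hT.2.trans (OmegaPlus_subset_raise hk h)

theorem lower_mem_W {L R : Tableau n} {k k' : Fin n} (hk : (k' : ℕ) = k + 1) :
    ∀ v ∈ W L R, lower k v ∈ W L R := by
  intro v hv
  rw [lower_eq]
  refine gtOp_mem_span (S := N L R) (fun T hT i h => ⟨?_, ?_⟩) v hv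
  · simpa using add_bump_mem_B hT.1 (p := k.succ) (by have := k'.2; simp; omega) i (-1)
  · exact hT.2.trans (OmegaPlus_subset_lower h)

theorem W_le_V (L R : Tableau n) : W L R ≤ V L :=
  Submodule.span_mono (Set.image_mono fun _ h => h.1)

/-- Endomorphisms of `V L` restricting the Gelfand-Tsetlin operators satisfy the Chevalley-Serre
relations. -/
theorem chevalleySerre {L : Tableau n} (hL : IsGeneric L) {e f h : ℕ → Module.End ℂ (V L)}
    (he : ∀ i (hi : i + 1 < n), Restricts (e i) (-gtOp ⟨i + 1, by omega⟩ ⟨i + 2, by omega⟩ 1))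
    (hf : ∀ i (hi : i + 1 < n), Restricts (f i) (gtOp ⟨i + 1, by omega⟩ ⟨i, by omega⟩ (-1)))
    (hh : ∀ i (hi : i < n), Restricts (h i) (diag ⟨i, hi⟩)) : ChevalleySerre n e f h := by
  constructor
  · intro i j hi hj
    refine ((hh i hi).lie (hh j hj)).eq Restricts.zero fun T hT => ?_
    simp only [end_lie_apply, diag_vec, map_smul, smul_smul]
    rw [mul_comm, sub_self]
    rfl
  · intro i j hi hj
    refine ((hh i hi).lie (he j hj)).eq (((he j hj).ite _).sub ((he j hj).ite _)) fun T hT => ?_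
    have := diag_gtOp ⟨i, hi⟩ ⟨j + 1, by omega⟩ ⟨j + 2, by omega⟩ 1 T
    rw [lie_neg, LinearMap.neg_apply, end_lie_apply, this]
    simp only [Fin.succ_mk, Fin.castSucc_mk, Fin.mk.injEq, Nat.add_right_cancel_iff]
    split_ifs <;> simp
  · intro i j hi hj
    refine ((hh i hi).lie (hf j hj)).eq (((hf j hj).ite _).sub ((hf j hj).ite _)) fun T hT => ?_
    have := diag_gtOp ⟨i, hi⟩ ⟨j + 1, by omega⟩ ⟨j, by omega⟩ (-1) T
    rw [end_lie_apply, this]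
    simp only [Fin.succ_mk, Fin.castSucc_mk, Fin.mk.injEq, Nat.add_right_cancel_iff]
    split_ifs <;> simp
  · intro i hi
    refine ((he i hi).lie (hf i hi)).eq ((hh i (by omega)).sub (hh (i + 1) hi)) fun T hT => ?_
    have := gtOp_commutator (p := ⟨i + 1, by omega⟩) (q := ⟨i + 2, by omega⟩)
      (r := ⟨i, by omega⟩) (by simp) (by simp) (hL.of_mem_B hT) hi (by simp) (by simp; omega)
    rw [neg_lie, LinearMap.neg_apply, end_lie_apply, neg_sub, this, LinearMap.sub_apply, diag_vec,
      diag_vec, ← sub_smul, diagCoeff, diagCoeff]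
    simp only [Fin.succ_mk, Fin.castSucc_mk]
    congr 1
    push_cast
    ring
  · intro i j hi hj hij
    refine ((he i hi).lie (hf j hj)).eq Restricts.zero fun T hT => ?_
    rw [neg_lie, LinearMap.neg_apply, end_lie_apply, LinearMap.zero_apply, neg_eq_zero, sub_eq_zero]
    -- Only in this case do the two operators read the rows shifted by each other.
    by_cases hj' : j = i + 1
    · subst hj'
      exact gtOp_comm_adjacent (by simp) 1 T
    · exact gtOp_comm_of_ne (by simpa using hij) (by simp; omega) (by simp; omega) _ _ T
  · intro i j hij hj
    refine ((he i (by omega)).lie (he j hj)).eq Restricts.zero fun T hT => ?_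
    rw [neg_lie, lie_neg, neg_neg, end_lie_apply, LinearMap.zero_apply, sub_eq_zero]
    exact gtOp_comm_of_ne (by simp; omega) (by simp; omega) (by simp; omega) _ _ T
  · intro i j hij hj
    refine ((hf i (by omega)).lie (hf j hj)).eq Restricts.zero fun T hT => ?_
    rw [end_lie_apply, LinearMap.zero_apply, sub_eq_zero]
    exact gtOp_comm_of_ne (by simp; omega) (by simp; omega) (by simp; omega) _ _ T
  · intro i hi
    refine ((he i (by omega)).lie ((he i (by omega)).lie (he (i + 1) hi))).eq Restricts.zero
      fun T hT => ?_
    simp only [neg_lie, lie_neg, neg_neg]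
    rw [LinearMap.neg_apply, LinearMap.zero_apply, neg_eq_zero]
    simp only [end_lie_apply, map_sub]
    exact gtOp_serre_left (by simp) (by simp) (Or.inl rfl) (hL.of_mem_B hT) (by simp; omega)
  · intro i hi
    refine ((he (i + 1) hi).lie ((he (i + 1) hi).lie (he i (by omega)))).eq Restricts.zero
      fun T hT => ?_
    simp only [neg_lie, lie_neg, neg_neg]
    rw [LinearMap.neg_apply, LinearMap.zero_apply, neg_eq_zero]
    simp only [end_lie_apply, map_sub]
    exact gtOp_serre_right (by simp) (by simp) (by simp) (Or.inl rfl) (hL.of_mem_B hT)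
      (by simp; omega)
  · intro i hi
    refine ((hf i (by omega)).lie ((hf i (by omega)).lie (hf (i + 1) hi))).eq Restricts.zero
      fun T hT => ?_
    rw [LinearMap.zero_apply]
    simp only [end_lie_apply, map_sub]
    -- Lowering reads the previous row, so `f (i + 1)` takes the role that `e i` had and the two
    -- Serre identities trade places.
    exact gtOp_serre_right (by simp) (by simp only [ne_eq, Fin.mk.injEq]; omega) (by simp)
      (Or.inr rfl) (hL.of_mem_B hT) (by simp; omega)
  · intro i hi
    refine ((hf (i + 1) hi).lie ((hf (i + 1) hi).lie (hf i (by omega)))).eq Restricts.zero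
      fun T hT => ?_
    rw [LinearMap.zero_apply]
    simp only [end_lie_apply, map_sub]
    exact gtOp_serre_left (by simp) (by simp only [ne_eq, Fin.mk.injEq]; omega) (Or.inr rfl)
      (hL.of_mem_B hT) (by simp; omega)

theorem exists_representation {L : Tableau n} (hL : IsGeneric L) (hn : 1 ≤ n) :
    ∃ ρ : gl n →ₗ⁅ℂ⁆ Module.End ℂ (V L), IsGivenByFormulas (V L) ρ := by
  classical
  -- Outside the index range the generators are set to 0; the Chevalley-Serre relations never look
  -- there.
  let e : ℕ → Module.End ℂ (V L) := fun i =>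
    if hi : i + 1 < n then
      (raise ⟨i, by omega⟩ ⟨i + 1, hi⟩).restrict (raise_mem_V (L := L) rfl) else 0
  let f : ℕ → Module.End ℂ (V L) := fun i =>
    if hi : i + 1 < n then
      (lower ⟨i, by omega⟩).restrict (lower_mem_V (L := L) (k' := ⟨i + 1, hi⟩) rfl) else 0
  let h : ℕ → Module.End ℂ (V L) := fun i =>
    if hi : i < n then (diag ⟨i, hi⟩).restrict (diag_mem_span (S := B L) ⟨i, hi⟩) else 0
  have he : ∀ i (hi : i + 1 < n), Restricts (e i) (raise ⟨i, by omega⟩ ⟨i + 1, hi⟩) := by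
    intro i hi v
    simp only [e, dif_pos hi]
    rfl
  have hf : ∀ i (hi : i + 1 < n), Restricts (f i) (lower ⟨i, by omega⟩) := by
    intro i hi v
    simp only [f, dif_pos hi]
    rfl
  have hh : ∀ i (hi : i < n), Restricts (h i) (diag ⟨i, hi⟩) := by
    intro i hi v
    simp only [h, dif_pos hi]
    rfl
  have : IsAddTorsionFree (Module.End ℂ (V L)) :=
    letI : Module ℚ (Module.End ℂ (V L)) := Module.compHom _ (algebraMap ℚ ℂ)
    IsAddTorsionFree.of_module_rat _
  obtain ⟨m, rfl⟩ : ∃ m, n = m + 1 := ⟨n - 1, by omega⟩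
  obtain ⟨E, hE, hd, hg⟩ := (chevalleySerre hL
    (fun i hi => by have := he i hi; rwa [raise_eq] at this)
    (fun i hi => by have := hf i hi; rwa [lower_eq] at this) hh).exists_matrixUnits m le_rfl
  refine ⟨matrixLieHom (m + 1) E hE, ?_, ?_, ?_⟩
  · rintro k ⟨k', hk'⟩ hk v
    obtain rfl : k' = k + 1 := hk
    rw [matrixLieHom_single]
    change (E k (k + 1) v : Free (m + 1)) = _
    rw [(hg k (by omega)).1, he k hk']
  · intro k k' hk v
    rw [matrixLieHom_single, hk, (hg k (by have := k'.2; omega)).2,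
      hf k (by have := k'.2; omega)]
  · intro k v
    rw [matrixLieHom_single, hd k k.2, hh k k.2]

/-- The locus where two homomorphisms agree is a Lie subalgebra, and it contains the generators. -/
theorem IsGivenByFormulas.unique {M : Submodule ℂ (Free n)} {ρ ρ' : gl n →ₗ⁅ℂ⁆ Module.End ℂ M}
    (h : IsGivenByFormulas M ρ) (h' : IsGivenByFormulas M ρ') : ρ' = ρ := by
  let S : LieSubalgebra ℂ (gl n) :=
    { LinearMap.eqLocus (ρ' : gl n →ₗ[ℂ] Module.End ℂ M) (ρ : gl n →ₗ[ℂ] Module.End ℂ M) with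
      lie_mem' := by
        intro x y (hx : ρ' x = ρ x) (hy : ρ' y = ρ y)
        show ρ' ⁅x, y⁆ = ρ ⁅x, y⁆
        rw [LieHom.map_lie, LieHom.map_lie, hx, hy] }
  have hS : S = ⊤ := by
    refine eq_top_of_generators_mem S (fun k k' hk => ?_) (fun k k' hk => ?_) (fun k => ?_)
    · exact LinearMap.ext fun v => Subtype.ext ((h'.1 k k' hk v).trans (h.1 k k' hk v).symm)
    · exact LinearMap.ext fun v => Subtype.ext ((h'.2.1 k k' hk v).trans (h.2.1 k k' hk v).symm)
    · exact LinearMap.ext fun v => Subtype.ext ((h'.2.2 k v).trans (h.2.2 k v).symm)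
  refine LieHom.ext fun g => ?_
  have : g ∈ S := hS ▸ LieSubalgebra.mem_top g
  exact this

/-- A subspace stable under the generators is stable under the whole representation. -/
theorem IsGivenByFormulas.mem_of_generators {M U : Submodule ℂ (Free n)}
    {ρ : gl n →ₗ⁅ℂ⁆ Module.End ℂ M} (h : IsGivenByFormulas M ρ)
    (hr : ∀ k k' : Fin n, (k' : ℕ) = k + 1 → ∀ v ∈ U, raise k k' v ∈ U)
    (hl : ∀ k k' : Fin n, (k' : ℕ) = k + 1 → ∀ v ∈ U, lower k v ∈ U)
    (hd : ∀ k : Fin n, ∀ v ∈ U, diag k v ∈ U) (g : gl n) (v : M) (hv : (v : Free n) ∈ U) :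
    (ρ g v : Free n) ∈ U := by
  let S : LieSubalgebra ℂ (gl n) :=
    { carrier := {g | ∀ v : M, (v : Free n) ∈ U → (ρ g v : Free n) ∈ U}
      add_mem' := by
        intro x y hx hy v hv
        rw [map_add]
        exact add_mem (hx v hv) (hy v hv)
      zero_mem' := by
        intro v _
        rw [map_zero]
        exact zero_mem U
      smul_mem' := by
        intro c x hx v hv
        rw [map_smul]
        exact U.smul_mem c (hx v hv)
      lie_mem' := by
        intro x y hx hy v hv
        rw [LieHom.map_lie, end_lie_apply]
        exact sub_mem (hx _ (hy v hv)) (hy _ (hx v hv)) }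
  have hS : S = ⊤ := by
    refine eq_top_of_generators_mem S (fun k k' hk v hv => ?_) (fun k k' hk v hv => ?_)
      (fun k v hv => ?_)
    · rw [h.1 k k' hk v]; exact hr k k' hk v hv
    · rw [h.2.1 k k' hk v]; exact hl k k' hk v hv
    · rw [h.2.2 k v]; exact hd k v hv
  have : g ∈ S := hS ▸ LieSubalgebra.mem_top g
  exact this v hv

/-- The restriction of a representation to a stable subspace. -/
noncomputable def restrictHom {M U : Submodule ℂ (Free n)} (hU : U ≤ M)
    (ρ : gl n →ₗ⁅ℂ⁆ Module.End ℂ M)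
    (h : ∀ (g : gl n) (v : M), (v : Free n) ∈ U → (ρ g v : Free n) ∈ U) :
    gl n →ₗ⁅ℂ⁆ Module.End ℂ U where
  toFun g :=
    { toFun := fun w => ⟨ρ g (Submodule.inclusion hU w), h g _ w.2⟩
      map_add' := fun v w => Subtype.ext (by simp)
      map_smul' := fun c w => Subtype.ext (by simp) }
  map_add' x y := LinearMap.ext fun w => Subtype.ext (by simp)
  map_smul' c x := LinearMap.ext fun w => Subtype.ext (by simp)
  map_lie' := by
    intro x y
    refine LinearMap.ext fun w => Subtype.ext ?_
    show (ρ ⁅x, y⁆ (Submodule.inclusion hU w) : Free n) = _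
    rw [LieHom.map_lie, end_lie_apply, end_lie_apply]
    rfl

end Representation

end GelfandTsetlin

theorem mainTheorem6 (n : ℕ) (hn : 2 ≤ n) (L : GelfandTsetlin.Tableau n)
    (hL : GelfandTsetlin.IsGeneric L) :
    ∃ ρ : GelfandTsetlin.gl n →ₗ⁅ℂ⁆ Module.End ℂ (GelfandTsetlin.V L),
      GelfandTsetlin.IsGivenByFormulas (GelfandTsetlin.V L) ρ ∧
      (∀ ρ' : GelfandTsetlin.gl n →ₗ⁅ℂ⁆ Module.End ℂ (GelfandTsetlin.V L),
        GelfandTsetlin.IsGivenByFormulas (GelfandTsetlin.V L) ρ' → ρ' = ρ) ∧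
      ∀ R ∈ GelfandTsetlin.B L,
        ∃ hW : GelfandTsetlin.W L R ≤ GelfandTsetlin.V L,
        ∃ σ : GelfandTsetlin.gl n →ₗ⁅ℂ⁆ Module.End ℂ (GelfandTsetlin.W L R),
          GelfandTsetlin.IsGivenByFormulas (GelfandTsetlin.W L R) σ ∧
          ∀ (g : GelfandTsetlin.gl n) (w : GelfandTsetlin.W L R),
            Submodule.inclusion hW (σ g w) = ρ g (Submodule.inclusion hW w) := by
  obtain ⟨ρ, hρ⟩ := GelfandTsetlin.exists_representation hL (by omega)
  refine ⟨ρ, hρ, fun ρ' hρ' => hρ.unique hρ', fun R _ => ⟨GelfandTsetlin.W_le_V L R,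
    GelfandTsetlin.restrictHom (GelfandTsetlin.W_le_V L R) ρ fun g v hv =>
      hρ.mem_of_generators (fun _ _ hk => GelfandTsetlin.raise_mem_W hk)
        (fun _ _ hk => GelfandTsetlin.lower_mem_W hk)
        (fun k => GelfandTsetlin.diag_mem_span (S := GelfandTsetlin.N L R) k) g v hv,
    ⟨fun k k' hk v => hρ.1 k k' hk _, fun k k' hk v => hρ.2.1 k k' hk _,
      fun k v => hρ.2.2 k _⟩, fun _ _ => rfl⟩⟩
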